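/- Notation. For a unit vector $\eta\in S^2\subset\mathbb R^3$ and $p\in\mathbb R$, and a bounded, compactly supported measurable vector field $\mathbf f$ on $\mathbb R^3$, let $\mathbf R\mathbf f(p,\eta)=\int_{\{y\,:\,y\cdot\eta=p\}}\mathbf f(y)\,dy$ be the (componentwise) Radon transform, let $\mathbf R^{(nor)}\mathbf f(p,\eta)=(\eta\cdot\mathbf R\mathbf f(p,\eta))\,\eta$ and $\mathbf R^{(tan)}\mathbf f=\mathbf R\mathbf f-\mathbf R^{(nor)}\mathbf f$ be its normal and tangential parts, and let $$\mathbf f^{(1)}(x)=-\frac1{8\pi^2}\int_{S^2}\partial_p^2\mathbf R^{(tan)}\mathbf f(p,\eta)\big|_{p=\eta\cdot x}\,d\eta$$ be the first part of $\mathbf f$ (the Radon inversion formula applied to the tangential part only). For an open set $D$, a field $\mathbf f^s$ is the solenoidal part of $\mathbf f$ in $D$ if $\mathbf f=\mathbf f^s+\nabla\varphi$ and $\nabla\cdot\mathbf f^s=0$ in $D$ for some $\varphi\in C^2(D)\cap C(\overline D)$ with $\varphi=0$ on $\partial D$. The second part of $\mathbf f$ is $\mathbf f^{(2)}=\mathbf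 f^s-\mathbf f^{(1)}$. (1) Let $D\subset\mathbb R^3$ be a bounded convex open set with smooth boundary, and let $\mathbf f$ be a real vector field that is smooth on $\overline D$ (up to the boundary, i.e. equal there to the restriction of a smooth field on $\mathbb R^3$) and zero outside $\overline D$. Then for $x\in D$ the derivative and the integral defining $\mathbf f^{(1)}(x)$ exist: for every $\eta\in S^2$ the function $p\mapsto\mathbf R^{(tan)}\mathbf f(p,\eta)$ is $C^2$ near $p=\eta\cdot x$, and the integrand is integrable over $S^2$. The field $\mathbf f^{(1)}$ is differentiable in $D$, and $$\nabla\times\mathbf f=\nabla\times\mathbf f^{(1)},\qquad \nabla\cdot\mathbf f^{(1)}=0\qquad\text{in } D.$$ Hence, if $\mathbf f^s$ is the solenoidal part of $\mathbf f$ in $D$, there is a harmonic function $h$ on $D$ (that is, $\Delta h=0$) with $\mathbf f^s-\mathbf f^{(1)}=\nabla h$ in $D$. (2) Let $D=B^3$ be the open unit ball, and let $\mathbf f$ be as in (1). If $\nabla\cdot\mathbf f=0$ in $B^3$ and $\mathbf f(\eta)\cdot\eta=0$ for all $\eta\in S^2$, then $\mathbf f^{(2)}=0$ in $B^3$. -/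

import Mathlib

open scoped ContDiff

noncomputable section

/-- Euclidean three-space. -/
abbrev E3 : Type := EuclideanSpace ℝ (Fin 3)

/-- The unit sphere `S²`, as a type. -/
abbrev S2 : Type := Metric.sphere (0 : E3) 1

/-- `∂ᵢ Fⱼ (x)`. -/
def partialDeriv (i j : Fin 3) (F : E3 → E3) (x : E3) : ℝ :=
  (fderiv ℝ F x (EuclideanSpace.single i 1)) j

/-- Divergence of a vector field. -/
def divergence (F : E3 → E3) (x : E3) : ℝ :=
  ∑ i, partialDeriv i i F x

/-- Curl of a vector field. -/
def curl (F : E3 → E3) (x : E3) : E3 :=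
  !₂[partialDeriv 1 2 F x - partialDeriv 2 1 F x,
     partialDeriv 2 0 F x - partialDeriv 0 2 F x,
     partialDeriv 0 1 F x - partialDeriv 1 0 F x]

/-- The open set `D` has a smooth boundary: near each of its boundary points it is the
sublevel set of a smooth function with non-vanishing differential at that point. -/
def HasSmoothBoundary (D : Set E3) : Prop :=
  ∀ x ∈ frontier D, ∃ ρ : E3 → ℝ, ContDiff ℝ ∞ ρ ∧ fderiv ℝ ρ x ≠ 0 ∧
    ∀ᶠ y in nhds x, (y ∈ D ↔ ρ y < 0)

/-- `f` is smooth up to the boundary on the closure of `D` (it is there the restriction of a smooth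
field on the whole space) and is zero outside the closure of `D`. -/
def IsSmoothFieldSupportedIn (D : Set E3) (f : E3 → E3) : Prop :=
  (∃ F : E3 → E3, ContDiff ℝ ∞ F ∧ Set.EqOn f F (closure D)) ∧ ∀ x ∉ closure D, f x = 0

/-- Componentwise Radon transform: the integral of `f` over the plane `{y | ⟪η, y⟫ = p}`
with respect to its two-dimensional Lebesgue measure (for unit vectors `η`). -/
def radon (f : E3 → E3) (p : ℝ) (η : E3) : E3 :=
  ∫ y : (Submodule.span ℝ {η})ᗮ, f (p • η + (y : E3))

/-- Normal component of the Radon transform. -/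
def radonNor (f : E3 → E3) (p : ℝ) (η : E3) : E3 :=
  (inner ℝ η (radon f p η)) • η

/-- Tangential component of the Radon transform. -/
def radonTan (f : E3 → E3) (p : ℝ) (η : E3) : E3 :=
  radon f p η - radonNor f p η

/-- `(∂_p² R^{tan} f)(p, η)` at `p = ⟪η, x⟫`. -/
def radonTanSecond (f : E3 → E3) (x : E3) (η : S2) : E3 :=
  iteratedDeriv 2 (fun p : ℝ => radonTan f p (η : E3)) (inner ℝ (η : E3) x)

/-- The surface measure of `S²` (of total mass `4π`). -/
def surfaceMeasure : MeasureTheory.Measure S2 :=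
  (MeasureTheory.volume : MeasureTheory.Measure E3).toSphere

/-- The first part `f⁽¹⁾`: the Radon inversion formula
`-(1 / 8π²) ∫_{S²} ∂_p² R f (⟪η, x⟫, η) dη` applied to the tangential part of `R f`. -/
def firstPart (f : E3 → E3) (x : E3) : E3 :=
  (-(1 / (8 * Real.pi ^ 2))) • ∫ η, radonTanSecond f x η ∂surfaceMeasure

/-- `fs` is, on `D`, the solenoidal part of `f`: `f = fs + ∇φ` and `div fs = 0` in `D`, where the
potential `φ` vanishes on the boundary of `D`. -/
def IsSolenoidalPart (D : Set E3) (f fs : E3 → E3) : Prop :=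
  ∃ φ : E3 → ℝ, ContDiffOn ℝ 2 φ D ∧ ContinuousOn φ (closure D) ∧ (∀ x ∈ frontier D, φ x = 0) ∧
    (∀ x ∈ D, f x = fs x + gradient φ x) ∧ ∀ x ∈ D, divergence fs x = 0

/-- The second part `f⁽²⁾` of the decomposition `f^s = f⁽¹⁾ + f⁽²⁾` of the solenoidal part `fs`
of `f`. -/
def secondPart (f fs : E3 → E3) (x : E3) : E3 :=
  fs x - firstPart f x

end

/-! The heart of the matter is an identity `firstPart f = f + ∇ω` in `D` with an explicit potential
`ω`. Radon inversion applied to the full transform returns `f`. What the tangential part omits is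
the normal part, whose `i`-th component is `∑ j, η_j η_i R f_j`. One factor `η_i` of its second
derivative is the `i`-th derivative in `x` of `∂_p R f_j (η·x, η)`, so its backprojection is a
gradient. Hence `ω` is `1/(8π²)` times the integral over the sphere of `∑ j, η_j ∂_p R f_j (η·x,
η)`. The curl identity is immediate, and `∑ i, η_i² = 1` together with the inversion formula gives
`Δω = -div f`. If `f = fs + ∇φ`, then `Δφ = div f`, so `fs - firstPart f = -∇(φ + ω)` with `φ + ω`
harmonic.

The analytic difficulty is that `f` jumps across the boundary of `D`, so `R f` need not be smooth
everywhere. At `p = η·x` with `x` inside `D` it is: in polar coordinates of the plane about an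
interior point, with radii rescaled by the distance to the boundary, the integral runs over a fixed
domain with a smooth integrand (`contDiffAt_exitRadius`, `radonScalar_eq_integral_polar`). Convexity
makes every ray cross the boundary once and transversally. Compactness of the set of directions
makes all bounds uniform (`exists_radonScalar_regularity`), which legitimises differentiation under
the integral over the sphere.

The inversion formula is proved without Fourier analysis. For a slab of half width `ε` the
combination `slab(2ε)/2 - slab(ε)` equals `ε³ ∂_p² R g` up to `O(ε⁴)`. By Archimedes' theorem on
zones, its average over directions is convolution with a compactly supported radial kernel of
integral `-8π²`.

On the ball, a divergence free field tangential to the sphere is orthogonal to all gradients.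
Testing with functions of `η·y` shows that `η·R f (p, η) = 0` for `|p| < 1`, so `ω = 0` and
`firstPart f = f`. The maximum principle gives `φ = 0`, so `fs = f` as well. -/

open Filter Topology MeasureTheory

/-! ### The exit radius of a convex domain with smooth boundary -/

/-- The parameter at which the ray from `p.1` in direction `p.2` leaves the closure of `D`. -/
noncomputable def exitRadius (D : Set E3) (p : E3 × E3) : ℝ :=
  sSup {r : ℝ | 0 ≤ r ∧ p.1 + r • p.2 ∈ closure D}

/-- The set of admissible radii is closed and bounded, so its supremum is attained. Convexity puts
the open segment from an interior point to a point of the closure inside `D`; openness prevents the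
endpoint from lying in `D`. -/
theorem exitRadius_spec {D : Set E3} (hD : IsOpen D) (hc : Convex ℝ D)
    (hb : Bornology.IsBounded D) {z v : E3} (hz : z ∈ D) (hv : v ≠ 0) :
    0 < exitRadius D (z, v) ∧ (∀ s, 0 ≤ s → s < exitRadius D (z, v) → z + s • v ∈ D) ∧
      (∀ s, exitRadius D (z, v) < s → z + s • v ∉ closure D) ∧
      z + exitRadius D (z, v) • v ∈ frontier D := by
  set S : Set ℝ := {r : ℝ | 0 ≤ r ∧ z + r • v ∈ closure D} with hS
  have hcont : Continuous fun r : ℝ => z + r • v := by fun_prop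
  have h0 : (0 : ℝ) ∈ S := ⟨le_rfl, by simpa using subset_closure hz⟩
  have hvn : 0 < ‖v‖ := norm_pos_iff.2 hv
  obtain ⟨M, hM⟩ := hb.closure.exists_norm_le
  have hbdd : BddAbove S := by
    refine ⟨(M + ‖z‖) / ‖v‖, fun r hr => ?_⟩
    rw [le_div_iff₀ hvn]
    have h1 : ‖r • v‖ = r * ‖v‖ := by rw [norm_smul, Real.norm_of_nonneg hr.1]
    have h2 : ‖r • v‖ ≤ ‖z + r • v‖ + ‖z‖ := by
      simpa using norm_sub_le (z + r • v) z
    linarith [hM _ hr.2]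
  have hclosed : IsClosed S :=
    (isClosed_le continuous_const continuous_id).inter (isClosed_closure.preimage hcont)
  have hR : exitRadius D (z, v) = sSup S := rfl
  have hmem : sSup S ∈ S := hclosed.csSup_mem ⟨0, h0⟩ hbdd
  have hopen : ∀ r : ℝ, 0 ≤ r → z + r • v ∈ D → r < sSup S := by
    intro r hr h
    have : ∀ᶠ s in 𝓝[>] r, z + s • v ∈ D :=
      nhdsWithin_le_nhds ((hD.preimage hcont).mem_nhds h)
    obtain ⟨s, hs, hrs⟩ := (this.and self_mem_nhdsWithin).exists
    have hrs' : r < s := hrs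
    exact lt_of_lt_of_le hrs' (le_csSup hbdd ⟨hr.trans hrs'.le, subset_closure hs⟩)
  have hpos : 0 < sSup S := hopen 0 le_rfl (by simpa using hz)
  rw [hR]
  refine ⟨hpos, fun s hs0 hs => ?_, fun s hs h => ?_, ?_⟩
  · rcases hs0.eq_or_lt with rfl | hs0
    · simpa using hz
    have := hc.openSegment_interior_closure_subset_interior
      (by rwa [hD.interior_eq] : z ∈ interior D) hmem.2
    rw [hD.interior_eq] at this
    apply this
    refine ⟨1 - s / sSup S, s / sSup S, ?_, by positivity, by ring, ?_⟩
    · rw [sub_pos, div_lt_one hpos]; exact hs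
    · rw [smul_add, ← add_assoc, ← add_smul, smul_smul, div_mul_cancel₀ _ hpos.ne']
      simp
  · exact absurd (le_csSup hbdd ⟨hpos.le.trans hs.le, h⟩) (not_le.2 hs)
  · rw [hD.frontier_eq]
    exact ⟨hmem.2, fun h => lt_irrefl _ (hopen _ hmem.1 h)⟩

/-- Points on the ray before the exit lie in the open set `D`, points after it in the open
complement of the closure. Both conditions persist under perturbation of the base point and the
direction. -/
theorem continuousAt_exitRadius {D : Set E3} (hD : IsOpen D) (hc : Convex ℝ D)
    (hb : Bornology.IsBounded D) {z v : E3} (hz : z ∈ D) (hv : v ≠ 0) :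
    ContinuousAt (exitRadius D) (z, v) := by
  obtain ⟨h0, h1, h2, -⟩ := exitRadius_spec hD hc hb hz hv
  have hev : ∀ᶠ p : E3 × E3 in 𝓝 (z, v), p.1 ∈ D ∧ p.2 ≠ 0 :=
    (continuous_fst.continuousAt.eventually (hD.mem_nhds hz)).and
      (continuous_snd.continuousAt.eventually_ne hv)
  rw [ContinuousAt, tendsto_order]
  constructor
  · intro a ha
    obtain ⟨s, hs, hs'⟩ := exists_between (max_lt ha h0)
    have hs0 : 0 ≤ s := (le_max_right a 0).trans hs.le
    have hcont : Continuous fun p : E3 × E3 => p.1 + s • p.2 := by fun_prop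
    filter_upwards [hev, hcont.continuousAt.eventually (hD.mem_nhds (h1 s hs0 hs'))] with p hp hps
    refine lt_of_lt_of_le (lt_of_le_of_lt (le_max_left a 0) hs) (le_of_not_gt fun h => ?_)
    exact (exitRadius_spec hD hc hb hp.1 hp.2).2.2.1 s h (subset_closure hps)
  · intro a ha
    obtain ⟨s, hs, hs'⟩ := exists_between ha
    have hcont : Continuous fun p : E3 × E3 => p.1 + s • p.2 := by fun_prop
    filter_upwards [hev, hcont.continuousAt.eventually
      (isClosed_closure.isOpen_compl.mem_nhds (h2 s hs))] with p hp hps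
    refine lt_of_le_of_lt (le_of_not_gt fun h => ?_) hs'
    exact hps (subset_closure ((exitRadius_spec hD hc hb hp.1 hp.2).2.1 s (h0.trans hs).le h))

/-- A defining function is prescribed only through its sign on `D`. A positive value at a frontier
point would keep a whole neighbourhood out of `D`, and a negative value would put the point into
`D`. -/
theorem eventually_frontier_eq_zero {D : Set E3} (hD : IsOpen D) {b : E3} {q : E3 → ℝ}
    (hq : Continuous q) (hqD : ∀ᶠ y in 𝓝 b, (y ∈ D ↔ q y < 0)) :
    ∀ᶠ y in 𝓝 b, y ∈ frontier D → q y = 0 := by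
  filter_upwards [eventually_eventually_nhds.2 hqD] with y hy hyf
  rw [hD.frontier_eq] at hyf
  refine le_antisymm (le_of_not_gt fun h => ?_) (le_of_not_gt fun h => ?_)
  · have h1 : ∀ᶠ y' in 𝓝 y, y' ∉ D := by
      filter_upwards [hy, hq.continuousAt.eventually (lt_mem_nhds h)] with y' h1 h2 h3
      exact lt_asymm h2 (h1.1 h3)
    exact (mem_closure_iff_frequently.1 hyf.1) h1
  · exact hyf.2 (hy.self_of_nhds.2 h)

/-- Transversality of rays to the boundary. Convexity gives the weak inequality, since `q` is
negative along the segment from `b` to `z`. Equality is impossible: `D` is open, so `z` could be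
moved in a direction in which the nonzero differential increases. -/
theorem fderiv_defining_function_pos {D : Set E3} (hD : IsOpen D) (hc : Convex ℝ D)
    {b : E3} (hbf : b ∈ frontier D) {q : E3 → ℝ} (hq : Differentiable ℝ q)
    (hq0 : fderiv ℝ q b ≠ 0) (hqD : ∀ᶠ y in 𝓝 b, (y ∈ D ↔ q y < 0)) {z : E3} (hz : z ∈ D) :
    fderiv ℝ q b (z - b) < 0 := by
  have hqb : q b = 0 := (eventually_frontier_eq_zero hD hq.continuous hqD).self_of_nhds hbf
  have key : ∀ z ∈ D, fderiv ℝ q b (z - b) ≤ 0 := by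
    intro z hz
    have hline : HasDerivAt (fun t : ℝ => b + t • (z - b)) (z - b) 0 := by
      simpa using ((hasDerivAt_id (0 : ℝ)).smul_const (z - b)).const_add b
    have hd : HasDerivAt (fun t : ℝ => q (b + t • (z - b))) (fderiv ℝ q b (z - b)) 0 := by
      have : HasFDerivAt q (fderiv ℝ q b) (b + (0 : ℝ) • (z - b)) := by
        simpa using (hq b).hasFDerivAt
      exact this.comp_hasDerivAt 0 hline
    have hs := hd.tendsto_slope_zero_right
    have hcl : ∀ᶠ t in 𝓝[>] (0 : ℝ), b + t • (z - b) ∈ D → q (b + t • (z - b)) < 0 := by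
      have : Tendsto (fun t : ℝ => b + t • (z - b)) (𝓝[>] 0) (𝓝 b) := by
        have := hline.continuousAt.tendsto
        simp only [zero_smul, add_zero] at this
        exact this.mono_left nhdsWithin_le_nhds
      exact (this.eventually hqD).mono fun t ht h => ht.1 h
    refine le_of_tendsto hs ?_
    filter_upwards [hcl, Ioo_mem_nhdsGT (zero_lt_one' ℝ)] with t ht ht1
    have hmem : b + t • (z - b) ∈ D := by
      have := hc.openSegment_interior_closure_subset_interior
        (by rwa [hD.interior_eq] : z ∈ interior D) (frontier_subset_closure hbf)
      rw [hD.interior_eq] at this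
      apply this
      refine ⟨t, 1 - t, ht1.1, by linarith [ht1.2], by ring, ?_⟩
      module
    have h1 := ht hmem
    simp only [zero_add, zero_smul, add_zero, hqb, sub_zero, smul_eq_mul]
    exact mul_nonpos_of_nonneg_of_nonpos (inv_nonneg.2 ht1.1.le) h1.le
  obtain ⟨w, hw⟩ : ∃ w, 0 < fderiv ℝ q b w := by
    by_contra! h
    apply hq0
    ext w
    refine le_antisymm (h w) ?_
    have := h (-w)
    rw [map_neg] at this
    simpa using this
  have hev : ∀ᶠ t in 𝓝[>] (0 : ℝ), z + t • w ∈ D := by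
    have hcont : Continuous fun t : ℝ => z + t • w := by fun_prop
    exact nhdsWithin_le_nhds ((hD.preimage hcont).mem_nhds (by simpa using hz))
  obtain ⟨t, ht, ht0⟩ := (hev.and self_mem_nhdsWithin).exists
  have h1 := key _ ht
  have h2 : z + t • w - b = (z - b) + t • w := by abel
  rw [h2, map_add, map_smul, smul_eq_mul] at h1
  have := mul_pos (show (0 : ℝ) < t from ht0) hw
  linarith

/-- The implicit function theorem for `q (z + r • v) = 0`, solved for `r`; transversality is the
nondegeneracy condition. -/
theorem contDiffAt_exitRadius {D : Set E3} (hD : IsOpen D) (hc : Convex ℝ D)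
    (hb : Bornology.IsBounded D) (hs : HasSmoothBoundary D) {z v : E3} (hz : z ∈ D) (hv : v ≠ 0) :
    ContDiffAt ℝ ∞ (exitRadius D) (z, v) := by
  obtain ⟨h0, h1, h2, h3⟩ := exitRadius_spec hD hc hb hz hv
  set R := exitRadius D (z, v) with hR
  obtain ⟨q, hq, hq0, hqD⟩ := hs _ h3
  have hqd : Differentiable ℝ q := hq.differentiable (by simp)
  have hpos : 0 < fderiv ℝ q (z + R • v) v := by
    have := fderiv_defining_function_pos hD hc h3 hqd hq0 hqD hz
    have h4 : z - (z + R • v) = -(R • v) := by abel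
    rw [h4, map_neg, map_smul, smul_eq_mul, neg_lt_zero] at this
    exact (pos_iff_pos_of_mul_pos this).1 h0
  set f : (E3 × E3) × ℝ → ℝ := fun u => q (u.1.1 + u.2 • u.1.2) with hf
  have hfc : ContDiff ℝ ∞ f := hq.comp (by fun_prop)
  set u : (E3 × E3) × ℝ := ((z, v), R) with hu
  have hfr := eventually_frontier_eq_zero hD hq.continuous hqD
  have hfu : f u = 0 := hfr.self_of_nhds h3
  have hder : ∀ t : ℝ, (fderiv ℝ f u ∘L .inr ℝ (E3 × E3) ℝ) t = t * fderiv ℝ q (z + R • v) v := by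
    intro t
    have hl : HasDerivAt (fun s : ℝ => z + s • v) v R := by
      simpa using ((hasDerivAt_id R).smul_const v).const_add z
    have e1 : HasDerivAt (fun s : ℝ => f ((z, v), s)) (fderiv ℝ q (z + R • v) v) R :=
      (hqd _).hasFDerivAt.comp_hasDerivAt R hl
    have e2 : HasDerivAt (fun s : ℝ => f ((z, v), s)) (fderiv ℝ f u (0, 1)) R :=
      ((hfc.differentiable (by simp)) u).hasFDerivAt.comp_hasDerivAt R
        ((hasDerivAt_const R (z, v)).prodMk (hasDerivAt_id R))
    rw [e1.unique e2]
    have : ((0 : E3 × E3), t) = t • ((0 : E3 × E3), (1 : ℝ)) := by ext <;> simp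
    simp only [ContinuousLinearMap.comp_apply, ContinuousLinearMap.inr_apply]
    rw [this, map_smul, smul_eq_mul]
  have hinv : (fderiv ℝ f u ∘L .inr ℝ (E3 × E3) ℝ).IsInvertible := by
    refine ⟨ContinuousLinearEquiv.unitsEquivAut ℝ (Units.mk0 _ hpos.ne'), ?_⟩
    ext
    simp [hder]
  have hn : (∞ : WithTop ℕ∞) ≠ 0 := by simp
  have hca : ContDiffAt ℝ ∞ f u := hfc.contDiffAt
  have hψ := hca.contDiffAt_implicitFunction hn hinv
  refine hψ.congr_of_eventuallyEq ?_
  have hiff := hca.eventually_apply_eq_iff_implicitFunction hn hinv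
  -- The implicit function is the unique solution only near `(z, v, R)`. Continuity keeps the exit
  -- radius in that neighbourhood and so identifies the two.
  have hcont := continuousAt_exitRadius hD hc hb hz hv
  have ht : Tendsto (fun p : E3 × E3 => (p, exitRadius D p)) (𝓝 (z, v)) (𝓝 u) :=
    tendsto_id.prodMk_nhds hcont
  have ht2 : Tendsto (fun p : E3 × E3 => p.1 + exitRadius D p • p.2) (𝓝 (z, v))
      (𝓝 (z + R • v)) :=
    (continuousAt_fst.add (hcont.smul continuousAt_snd)).tendsto
  have hev : ∀ᶠ p : E3 × E3 in 𝓝 (z, v), p.1 ∈ D ∧ p.2 ≠ 0 :=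
    (continuous_fst.continuousAt.eventually (hD.mem_nhds hz)).and
      (continuous_snd.continuousAt.eventually_ne hv)
  filter_upwards [ht.eventually hiff, ht2.eventually hfr, hev] with p hp1 hp2 hp3
  refine (hp1.1 ?_).symm
  rw [hfu]
  exact hp2 (exitRadius_spec hD hc hb hp3.1 hp3.2).2.2.2

/-! ### Orthonormal frames and slicing by parallel planes -/

theorem exists_orthonormalBasis_zero_eq {η : E3} (hη : ‖η‖ = 1) :
    ∃ b : OrthonormalBasis (Fin 3) ℝ E3, b 0 = η := by
  have hv : Orthonormal ℝ (({0} : Set (Fin 3)).domRestrict fun _ => η) := by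
    refine ⟨fun i => hη, fun i j hij => ?_⟩
    exact absurd (Subsingleton.elim i j) hij
  obtain ⟨b, hb⟩ := hv.exists_orthonormalBasis_extension_of_card_eq (by simp)
  exact ⟨b, hb 0 rfl⟩

/-- Cartesian coordinates along an orthonormal basis. -/
noncomputable def frameEquiv (b : OrthonormalBasis (Fin 3) ℝ E3) : ℝ × ℝ × ℝ ≃ᵐ E3 :=
  (((MeasurableEquiv.refl ℝ).prodCongr MeasurableEquiv.finTwoArrow.symm).trans
    (MeasurableEquiv.piFinSuccAbove (fun _ : Fin 3 => ℝ) 0).symm).trans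
      ((MeasurableEquiv.toLp 2 (Fin 3 → ℝ)).trans b.repr.symm.toMeasurableEquiv)

theorem frameEquiv_apply (b : OrthonormalBasis (Fin 3) ℝ E3) (q : ℝ × ℝ × ℝ) :
    frameEquiv b q = q.1 • b 0 + (q.2.1 • b 1 + q.2.2 • b 2) := by
  have : frameEquiv b q = b.repr.symm (WithLp.toLp 2 ![q.1, q.2.1, q.2.2]) := by
    simp only [frameEquiv, MeasurableEquiv.trans_apply]
    rw [LinearIsometryEquiv.coe_toMeasurableEquiv]
    congr 1
    ext i
    fin_cases i <;> rfl
  rw [this, ← b.sum_repr_symm]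
  simp [Fin.sum_univ_three, add_assoc]

theorem measurePreserving_frameEquiv (b : OrthonormalBasis (Fin 3) ℝ E3) :
    MeasurePreserving (frameEquiv b) := by
  unfold frameEquiv
  have h1 : MeasurePreserving
      ((MeasurableEquiv.refl ℝ).prodCongr (MeasurableEquiv.finTwoArrow (α := ℝ)).symm) :=
    (MeasurePreserving.id volume).prod (volume_preserving_finTwoArrow ℝ).symm
  have h2 := (volume_preserving_piFinSuccAbove (fun _ : Fin 3 => ℝ) 0).symm
  have h3 : MeasurePreserving (MeasurableEquiv.toLp 2 (Fin 3 → ℝ)) :=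
    PiLp.volume_preserving_toLp (Fin 3)
  have h4 : MeasurePreserving b.repr.symm.toMeasurableEquiv := b.measurePreserving_repr_symm
  exact (h4.comp h3).comp (h2.comp h1)

/-- The remaining two basis vectors form an orthonormal basis of the orthogonal plane, and
orthonormal coordinates preserve volume. -/
theorem integral_orthogonal_eq (b : OrthonormalBasis (Fin 3) ℝ E3) {F : Type*}
    [NormedAddCommGroup F] [NormedSpace ℝ F] (g : E3 → F) (p : ℝ) :
    ∫ y : (Submodule.span ℝ {b 0})ᗮ, g (p • b 0 + (y : E3)) =
      ∫ q : ℝ × ℝ, g (p • b 0 + (q.1 • b 1 + q.2 • b 2)) := by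
  set V := (Submodule.span ℝ {b 0})ᗮ
  have hmem : ∀ i : Fin 2, b i.succ ∈ V := by
    intro i
    rw [Submodule.mem_orthogonal_singleton_iff_inner_right]
    exact b.orthonormal.2 (by exact (Fin.succ_ne_zero i).symm)
  have hfin : Fact (Module.finrank ℝ E3 = 2 + 1) := ⟨by simp⟩
  have hdim : Module.finrank ℝ V = 2 :=
    Submodule.finrank_orthogonal_span_singleton (b.orthonormal.ne_zero 0)
  set w : Fin 2 → V := fun i => ⟨b i.succ, hmem i⟩
  have hw : Orthonormal ℝ ((Set.univ : Set (Fin 2)).domRestrict w) := by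
    refine ⟨fun i => b.orthonormal.1 _, fun i j hij => ?_⟩
    exact b.orthonormal.2 fun h => hij (Subtype.ext (Fin.succ_injective _ h))
  obtain ⟨c, hc⟩ := hw.exists_orthonormalBasis_extension_of_card_eq (by simp [hdim])
  have e : MeasurePreserving ((MeasurableEquiv.finTwoArrow.symm.trans
      (MeasurableEquiv.toLp 2 (Fin 2 → ℝ))).trans c.repr.symm.toMeasurableEquiv) := by
    have h3 : MeasurePreserving (MeasurableEquiv.toLp 2 (Fin 2 → ℝ)) :=
      PiLp.volume_preserving_toLp (Fin 2)
    have h4 : MeasurePreserving c.repr.symm.toMeasurableEquiv := c.measurePreserving_repr_symm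
    exact h4.comp (h3.comp (volume_preserving_finTwoArrow ℝ).symm)
  rw [← e.integral_comp' (g := fun y : V => g (p • b 0 + (y : E3)))]
  congr 1
  ext q
  have : (((MeasurableEquiv.finTwoArrow.symm.trans
      (MeasurableEquiv.toLp 2 (Fin 2 → ℝ))).trans c.repr.symm.toMeasurableEquiv) q)
        = c.repr.symm (WithLp.toLp 2 ![q.1, q.2]) := by
    simp only [MeasurableEquiv.trans_apply]
    rw [LinearIsometryEquiv.coe_toMeasurableEquiv]
    congr 1
  rw [this, ← c.sum_repr_symm]
  simp [Fin.sum_univ_two, hc 0 trivial, hc 1 trivial, w]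

theorem norm_frame_sq (b : OrthonormalBasis (Fin 3) ℝ E3) (p x y : ℝ) :
    ‖p • b 0 + (x • b 1 + y • b 2)‖ ^ 2 = p ^ 2 + x ^ 2 + y ^ 2 := by
  have := b.sum_sq_norm_inner_right (p • b 0 + (x • b 1 + y • b 2))
  rw [← this]
  have hb : ∀ i j, inner ℝ (b i) (b j) = if i = j then (1 : ℝ) else 0 := fun i j =>
    orthonormal_iff_ite.1 b.orthonormal i j
  simp [Fin.sum_univ_three, inner_add_right, inner_smul_right, hb]

theorem inner_frame (b : OrthonormalBasis (Fin 3) ℝ E3) (p x y : ℝ) :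
    inner ℝ (b 0) (p • b 0 + (x • b 1 + y • b 2)) = p := by
  have hb : ∀ i j, inner ℝ (b i) (b j) = if i = j then (1 : ℝ) else 0 := fun i j =>
    orthonormal_iff_ite.1 b.orthonormal i j
  simp only [inner_add_right, inner_smul_right, hb]
  simp

/-- The Radon transform of a scalar function. -/
noncomputable def radonScalar (g : E3 → ℝ) (η : E3) (p : ℝ) : ℝ :=
  ∫ y : (Submodule.span ℝ {η})ᗮ, g (p • η + (y : E3))

theorem radonScalar_frame (b : OrthonormalBasis (Fin 3) ℝ E3) (g : E3 → ℝ) (p : ℝ) :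
    radonScalar g (b 0) p = ∫ q : ℝ × ℝ, g (p • b 0 + (q.1 • b 1 + q.2 • b 2)) :=
  integral_orthogonal_eq b g p

theorem integral_eq_integral_frame (b : OrthonormalBasis (Fin 3) ℝ E3) (h : E3 → ℝ) :
    ∫ y, h y = ∫ q : ℝ × ℝ × ℝ, h (q.1 • b 0 + (q.2.1 • b 1 + q.2.2 • b 2)) := by
  rw [← (measurePreserving_frameEquiv b).integral_comp' (g := h)]
  simp_rw [frameEquiv_apply]

/-- Slicing by parallel planes, for a function multiplied by a plane wave. -/
theorem integral_planeWave_mul {η : E3} (hη : ‖η‖ = 1) {g : E3 → ℝ} {m : ℝ → ℝ}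
    (hg : Integrable fun y => m (inner ℝ η y) * g y) :
    ∫ y, m (inner ℝ η y) * g y = ∫ p, m p * radonScalar g η p := by
  obtain ⟨b, rfl⟩ := exists_orthonormalBasis_zero_eq hη
  rw [integral_eq_integral_frame b]
  have hint : Integrable fun q : ℝ × ℝ × ℝ => m q.1 *
      g (q.1 • b 0 + (q.2.1 • b 1 + q.2.2 • b 2)) := by
    have := ((measurePreserving_frameEquiv b).integrable_comp_emb
      (frameEquiv b).measurableEmbedding).2 hg
    refine this.congr (Eventually.of_forall fun q => ?_)
    simp only [Function.comp, frameEquiv_apply, inner_frame]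
  simp only [inner_frame]
  rw [Measure.volume_eq_prod, integral_prod _ hint]
  congr 1
  ext p
  rw [radonScalar_frame, ← integral_const_mul]

/-! ### Smooth functions cut off at the boundary of the domain -/

/-- A bounded convex open set with smooth boundary. -/
structure IsSmoothConvexDomain (D : Set E3) : Prop where
  isOpen : IsOpen D
  convex : Convex ℝ D
  isBounded : Bornology.IsBounded D
  hasSmoothBoundary : HasSmoothBoundary D

/-- The scalar function `g` coincides with the smooth function `F` on the closure of `D` and
vanishes outside it. -/
structure IsSmoothCutoff (D : Set E3) (F g : E3 → ℝ) : Prop where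
  contDiff : ContDiff ℝ ∞ F
  eqOn : Set.EqOn g F (closure D)
  eq_zero : ∀ x ∉ closure D, g x = 0

namespace IsSmoothCutoff

variable {D : Set E3} {F g : E3 → ℝ}

theorem eq_indicator (h : IsSmoothCutoff D F g) : g = (closure D).indicator F := by
  ext x
  by_cases hx : x ∈ closure D
  · rw [Set.indicator_of_mem hx, h.eqOn hx]
  · rw [Set.indicator_of_notMem hx, h.eq_zero x hx]

theorem measurable (h : IsSmoothCutoff D F g) : Measurable g := by
  rw [h.eq_indicator]
  exact h.contDiff.continuous.measurable.indicator isClosed_closure.measurableSet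

theorem exists_bound (h : IsSmoothCutoff D F g) (hb : Bornology.IsBounded D) :
    ∃ M, 0 ≤ M ∧ ∀ y, |g y| ≤ M := by
  obtain ⟨M, hM⟩ := hb.isCompact_closure.exists_bound_of_continuousOn
    h.contDiff.continuous.continuousOn
  refine ⟨max M 0, le_max_right _ _, fun y => ?_⟩
  by_cases hy : y ∈ closure D
  · rw [h.eqOn hy]
    exact (hM y hy).trans (le_max_left _ _)
  · rw [h.eq_zero y hy, abs_zero]
    exact le_max_right _ _

theorem exists_support_bound (h : IsSmoothCutoff D F g) (hb : Bornology.IsBounded D) :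
    ∃ R, 0 < R ∧ ∀ y, R < ‖y‖ → g y = 0 := by
  obtain ⟨R, hR0, hR⟩ := hb.closure.exists_pos_norm_le
  exact ⟨R, hR0, fun y hy => h.eq_zero y fun hy' => not_le.2 hy (hR y hy')⟩

theorem integrable (h : IsSmoothCutoff D F g) (hb : Bornology.IsBounded D) : Integrable g := by
  rw [h.eq_indicator, integrable_indicator_iff isClosed_closure.measurableSet]
  exact h.contDiff.continuous.continuousOn.integrableOn_compact hb.isCompact_closure

theorem continuousAt (h : IsSmoothCutoff D F g) (hD : IsOpen D) {x : E3} (hx : x ∈ D) :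
    ContinuousAt g x :=
  h.contDiff.continuous.continuousAt.congr <| by
    filter_upwards [hD.mem_nhds hx] with y hy
    exact (h.eqOn (subset_closure hy)).symm

end IsSmoothCutoff

/-! ### The Radon transform in polar coordinates about an interior point -/

theorem radonScalar_inner_frame (b : OrthonormalBasis (Fin 3) ℝ E3) (g : E3 → ℝ) (z : E3) :
    radonScalar g (b 0) (inner ℝ (b 0) z) =
      ∫ q : ℝ × ℝ, g (z + (q.1 • b 1 + q.2 • b 2)) := by
  rw [radonScalar_frame, ← integral_add_right_eq_self _ ((inner ℝ (b 1) z, inner ℝ (b 2) z) : ℝ × ℝ)]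
  congr 1
  ext q
  congr 1
  conv_rhs => rw [← b.sum_repr' z]
  simp only [Fin.sum_univ_three, Prod.fst_add, Prod.snd_add]
  module

/-- The unit vector at angle `φ` in the plane spanned by `u` and `v`. -/
noncomputable def circleVec (u v : E3) (φ : ℝ) : E3 := Real.cos φ • u + Real.sin φ • v

theorem norm_circleVec (b : OrthonormalBasis (Fin 3) ℝ E3) (φ : ℝ) :
    ‖circleVec (b 1) (b 2) φ‖ = 1 := by
  have h := norm_frame_sq b 0 (Real.cos φ) (Real.sin φ)
  rw [zero_smul, zero_add] at h
  have h2 : ‖circleVec (b 1) (b 2) φ‖ ^ 2 = 1 := by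
    rw [circleVec, h]; linarith [Real.sin_sq_add_cos_sq φ]
  exact (pow_eq_one_iff_of_nonneg (norm_nonneg _) two_ne_zero).1 h2

theorem continuous_circleVec (u v : E3) : Continuous (circleVec u v) := by
  unfold circleVec; fun_prop

/-- The integrand of the Radon transform in polar coordinates rescaled by the exit radius. -/
noncomputable def polarIntegrand (D : Set E3) (F : E3 → ℝ) (z v : E3) (s : ℝ) : ℝ :=
  F (z + (s * exitRadius D (z, v)) • v) * (exitRadius D (z, v) ^ 2 * s)

/-- The substitution `r = s * exitRadius D (z, v)` fixes the interval of integration. All dependence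
on `z` and `v` moves into the integrand, where the discontinuous `g` may be replaced by its smooth
extension `F`. -/
theorem integral_ray_eq {D : Set E3} (hD : IsSmoothConvexDomain D) {F g : E3 → ℝ}
    (hg : IsSmoothCutoff D F g) {z v : E3} (hz : z ∈ D) (hv : v ≠ 0) :
    ∫ r in Set.Ioi (0 : ℝ), r * g (z + r • v) = ∫ s in Set.Ioo (0 : ℝ) 1, polarIntegrand D F z v s := by
  obtain ⟨h0, h1, h2, h3⟩ := exitRadius_spec hD.isOpen hD.convex hD.isBounded hz hv
  set ρ := exitRadius D (z, v) with hρ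
  have e1 : ∫ r in Set.Ioi (0 : ℝ), r * g (z + r • v) = ∫ r in Set.Ioc 0 ρ, r * g (z + r • v) := by
    refine (setIntegral_eq_of_subset_of_forall_sdiff_eq_zero measurableSet_Ioi
      (fun r hr => hr.1) fun r hr => ?_)
    have : ρ < r := by
      by_contra h
      exact hr.2 ⟨hr.1, not_lt.1 h⟩
    rw [hg.eq_zero _ (h2 r this), mul_zero]
  have e2 : ∫ r in Set.Ioc 0 ρ, r * g (z + r • v) = ∫ r in Set.Ioc 0 ρ, r * F (z + r • v) := by
    refine setIntegral_congr_fun measurableSet_Ioc fun r hr => ?_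
    have hmem : z + r • v ∈ closure D := by
      rcases hr.2.eq_or_lt with h | h
      · rw [h]; exact frontier_subset_closure h3
      · exact subset_closure (h1 r hr.1.le h)
    simp only [hg.eqOn hmem]
  rw [e1, e2, ← intervalIntegral.integral_of_le h0.le, ← integral_Ioc_eq_integral_Ioo,
    ← intervalIntegral.integral_of_le zero_le_one]
  have e3 := intervalIntegral.integral_comp_mul_right (a := 0) (b := 1)
    (fun r => r * F (z + r • v)) h0.ne'
  rw [zero_mul, one_mul, eq_inv_smul_iff₀ h0.ne', smul_eq_mul,
    ← intervalIntegral.integral_const_mul] at e3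
  rw [← e3]
  refine intervalIntegral.integral_congr fun s _ => ?_
  simp only [polarIntegrand, ← hρ]
  ring

theorem radonScalar_eq_integral_polar {D : Set E3} (hD : IsSmoothConvexDomain D) {F g : E3 → ℝ}
    (hg : IsSmoothCutoff D F g) (b : OrthonormalBasis (Fin 3) ℝ E3) {z : E3} (hz : z ∈ D) :
    radonScalar g (b 0) (inner ℝ (b 0) z) =
      ∫ w in Set.Ioo (-Real.pi) Real.pi ×ˢ Set.Ioo (0 : ℝ) 1,
        polarIntegrand D F z (circleVec (b 1) (b 2) w.1) w.2 := by
  have hne : ∀ φ, circleVec (b 1) (b 2) φ ≠ 0 := fun φ => by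
    rw [← norm_pos_iff, norm_circleVec]; exact one_pos
  rw [radonScalar_inner_frame, ← integral_comp_polarCoord_symm]
  obtain ⟨M, hM0, hM⟩ := hg.exists_bound hD.isBounded
  obtain ⟨R, hR0, hR⟩ := hg.exists_support_bound hD.isBounded
  have hco : ∀ p : ℝ × ℝ, p.1 • g (z + ((polarCoord.symm p).1 • b 1 + (polarCoord.symm p).2 • b 2))
      = p.1 * g (z + p.1 • circleVec (b 1) (b 2) p.2) := by
    intro p
    rw [polarCoord_symm_apply, circleVec, smul_add, smul_smul, smul_smul, smul_eq_mul]
  simp_rw [hco]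
  have hmeas : Measurable fun p : ℝ × ℝ => p.1 * g (z + p.1 • circleVec (b 1) (b 2) p.2) := by
    have : Continuous fun p : ℝ × ℝ => z + p.1 • circleVec (b 1) (b 2) p.2 := by
      have := continuous_circleVec (b 1) (b 2)
      fun_prop
    exact measurable_fst.mul (hg.measurable.comp this.measurable)
  -- The polar domain is unbounded, but `g` vanishes beyond radius `R + ‖z‖` from `z`, which leaves
  -- a bounded function on a rectangle.
  have hint : IntegrableOn (fun p : ℝ × ℝ => p.1 * g (z + p.1 • circleVec (b 1) (b 2) p.2))
      polarCoord.target := by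
    have hfin : IntegrableOn (fun p : ℝ × ℝ => p.1 * g (z + p.1 • circleVec (b 1) (b 2) p.2))
        (Set.Ioc 0 (R + ‖z‖) ×ˢ Set.Ioo (-Real.pi) Real.pi) := by
      refine Measure.integrableOn_of_bounded (M := (R + ‖z‖) * M) ?_ hmeas.aestronglyMeasurable ?_
      · rw [Measure.volume_eq_prod, Measure.prod_prod]
        exact (ENNReal.mul_lt_top (by simp) (by simp)).ne
      · refine ae_restrict_of_forall_mem (measurableSet_Ioc.prod measurableSet_Ioo) fun p hp => ?_
        rw [norm_mul, Real.norm_of_nonneg hp.1.1.le]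
        exact mul_le_mul hp.1.2 (hM _) (norm_nonneg _) (hp.1.1.le.trans hp.1.2)
    rw [polarCoord_target]
    refine hfin.of_forall_sdiff_eq_zero (measurableSet_Ioi.prod measurableSet_Ioo) fun p hp => ?_
    have h1 : R + ‖z‖ < p.1 := by
      by_contra h
      exact hp.2 ⟨⟨hp.1.1, not_lt.1 h⟩, hp.1.2⟩
    rw [hR, mul_zero]
    have h2 := norm_sub_le (z + p.1 • circleVec (b 1) (b 2) p.2) z
    rw [add_sub_cancel_left, norm_smul, norm_circleVec, mul_one,
      Real.norm_of_nonneg (le_of_lt hp.1.1)] at h2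
    linarith
  rw [polarCoord_target] at hint ⊢
  rw [Measure.volume_eq_prod] at hint ⊢
  rw [IntegrableOn, ← Measure.prod_restrict] at hint
  rw [← Measure.prod_restrict, integral_prod_symm _ hint, ← Measure.prod_restrict, integral_prod]
  · refine integral_congr_ae (Eventually.of_forall fun φ => ?_)
    exact integral_ray_eq hD hg hz (hne φ)
  · rw [Measure.prod_restrict, ← Measure.volume_eq_prod]
    have hcont : Continuous fun w : ℝ × ℝ =>
        polarIntegrand D F z (circleVec (b 1) (b 2) w.1) w.2 := by
      have hc := continuous_circleVec (b 1) (b 2)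
      have hρ : Continuous fun w : ℝ × ℝ => exitRadius D (z, circleVec (b 1) (b 2) w.1) := by
        rw [continuous_iff_continuousAt]
        intro w
        have h1 := continuousAt_exitRadius hD.isOpen hD.convex hD.isBounded hz (hne w.1)
        exact ContinuousAt.comp (f := fun w : ℝ × ℝ => (z, circleVec (b 1) (b 2) w.1)) h1
          (by fun_prop)
      have hF := hg.contDiff.continuous
      unfold polarIntegrand
      fun_prop
    exact (hcont.continuousOn.integrableOn_compact
      (isCompact_Icc.prod isCompact_Icc)).mono_set
        (Set.prod_mono Set.Ioo_subset_Icc_self Set.Ioo_subset_Icc_self)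

/-! ### Differentiation under the integral sign with uniform bounds -/

section ParametricDerivative

variable {P : Type*} [NormedAddCommGroup P] [NormedSpace ℝ P]

/-- The `k`-th derivative in the first variable of a function on `ℝ × P`. -/
noncomputable def timeDeriv (Ψ : ℝ × P → ℝ) : ℕ → ℝ × P → ℝ
  | 0 => Ψ
  | k + 1 => fun q => fderiv ℝ (timeDeriv Ψ k) q (1, 0)

theorem contDiffOn_timeDeriv {Ψ : ℝ × P → ℝ} {O : Set (ℝ × P)} (hO : IsOpen O)
    (hΨ : ContDiffOn ℝ ∞ Ψ O) (k : ℕ) : ContDiffOn ℝ ∞ (timeDeriv Ψ k) O := by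
  induction k with
  | zero => exact hΨ
  | succ k ih => exact (ih.fderiv_of_isOpen hO (by simp)).clm_apply contDiffOn_const

theorem hasDerivAt_timeDeriv {Ψ : ℝ × P → ℝ} {O : Set (ℝ × P)} (hO : IsOpen O)
    (hΨ : ContDiffOn ℝ ∞ Ψ O) (k : ℕ) {t : ℝ} {p : P} (h : (t, p) ∈ O) :
    HasDerivAt (fun s => timeDeriv Ψ k (s, p)) (timeDeriv Ψ (k + 1) (t, p)) t := by
  have h1 : DifferentiableAt ℝ (timeDeriv Ψ k) (t, p) :=
    ((contDiffOn_timeDeriv hO hΨ k).contDiffAt (hO.mem_nhds h)).differentiableAt (by simp)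
  exact h1.hasFDerivAt.comp_hasDerivAt t ((hasDerivAt_id t).prodMk (hasDerivAt_const t p))

/-- The constant is chosen before the parametrisation `γ`: it depends on `γ` only through the
compact set `K`. With `γ` encoding a frame adapted to a direction, this yields bounds uniform in the
direction without a continuous choice of frames. -/
theorem exists_hasDerivAt_integral_timeDeriv {Ψ : ℝ × P → ℝ} {O : Set (ℝ × P)} (hO : IsOpen O)
    (hΨ : ContDiffOn ℝ ∞ Ψ O) {K : Set P} (hK : IsCompact K) {δ : ℝ}
    (hKO : Set.Icc (-δ) δ ×ˢ K ⊆ O) {W : Type*} [TopologicalSpace W] [MeasurableSpace W]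
    [OpensMeasurableSpace W] [SecondCountableTopology W]
    (μ : Measure W) {A : Set W} (hA : MeasurableSet A) (hμ : μ A ≠ ⊤) (k : ℕ) :
    ∃ C, ∀ γ : W → P, ContinuousOn γ A → Set.MapsTo γ A K → ∀ t, |t| < δ →
      HasDerivAt (fun t => ∫ w in A, timeDeriv Ψ k (t, γ w) ∂μ)
        (∫ w in A, timeDeriv Ψ (k + 1) (t, γ w) ∂μ) t ∧
      |∫ w in A, timeDeriv Ψ k (t, γ w) ∂μ| ≤ C := by
  have hbound : ∀ j, ∃ C, ∀ t ∈ Set.Icc (-δ) δ, ∀ p ∈ K, ‖timeDeriv Ψ j (t, p)‖ ≤ C := by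
    intro j
    obtain ⟨C, hC⟩ := (isCompact_Icc.prod hK).exists_bound_of_continuousOn
      ((contDiffOn_timeDeriv hO hΨ j).continuousOn.mono hKO)
    exact ⟨C, fun t ht p hp => hC (t, p) ⟨ht, hp⟩⟩
  obtain ⟨C0, hC0⟩ := hbound k
  obtain ⟨C1, hC1⟩ := hbound (k + 1)
  refine ⟨C0 * μ.real A, fun γ hγ hγK t ht => ?_⟩
  have hIoo : ∀ s ∈ Set.Ioo (-δ) δ, s ∈ Set.Icc (-δ) δ := fun s hs => Set.Ioo_subset_Icc_self hs
  have ht' : t ∈ Set.Ioo (-δ) δ := abs_lt.1 ht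
  have hmeas : ∀ j, ∀ s ∈ Set.Ioo (-δ) δ,
      AEStronglyMeasurable (fun w => timeDeriv Ψ j (s, γ w)) (μ.restrict A) := by
    intro j s hs
    refine ContinuousOn.aestronglyMeasurable ?_ hA
    exact (contDiffOn_timeDeriv hO hΨ j).continuousOn.comp (continuousOn_const.prodMk hγ)
      fun w hw => hKO ⟨hIoo s hs, hγK hw⟩
  have hfin : IsFiniteMeasure (μ.restrict A) := ⟨by simpa using hμ.lt_top⟩
  constructor
  · refine (hasDerivAt_integral_of_dominated_loc_of_deriv_le (bound := fun _ => C1)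
      (F' := fun t w => timeDeriv Ψ (k + 1) (t, γ w))
      (Ioo_mem_nhds ht'.1 ht'.2) ?_ ?_ (hmeas (k + 1) t ht') ?_ (integrable_const _) ?_).2
    · filter_upwards [Ioo_mem_nhds ht'.1 ht'.2] with s hs using hmeas k s hs
    · exact Integrable.of_bound (hmeas k t ht') C0
        (ae_restrict_of_forall_mem hA fun w hw => hC0 t (hIoo t ht') _ (hγK hw))
    · exact ae_restrict_of_forall_mem hA fun w hw s hs => hC1 s (hIoo s hs) _ (hγK hw)
    · exact ae_restrict_of_forall_mem hA fun w hw s hs =>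
        hasDerivAt_timeDeriv hO hΨ k (hKO ⟨hIoo s hs, hγK hw⟩)
  · exact norm_setIntegral_le_of_norm_le_const hμ.lt_top
      fun w hw => hC0 t (hIoo t ht') _ (hγK hw)

end ParametricDerivative

/-! ### Smoothness of the Radon transform at interior points -/

theorem contDiffAt_polarIntegrand {D : Set E3} (hD : IsSmoothConvexDomain D) {F : E3 → ℝ}
    (hF : ContDiff ℝ ∞ F) (x : E3) {q : ℝ × E3 × E3 × ℝ} (hq : x + q.1 • q.2.1 ∈ D)
    (hv : q.2.2.1 ≠ 0) :
    ContDiffAt ℝ ∞ (fun q : ℝ × E3 × E3 × ℝ =>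
      polarIntegrand D F (x + q.1 • q.2.1) q.2.2.1 q.2.2.2) q := by
  have hρ : ContDiffAt ℝ ∞ (fun q : ℝ × E3 × E3 × ℝ =>
      exitRadius D (x + q.1 • q.2.1, q.2.2.1)) q := by
    have h := contDiffAt_exitRadius hD.isOpen hD.convex hD.isBounded hD.hasSmoothBoundary hq hv
    exact ContDiffAt.comp (f := fun q : ℝ × E3 × E3 × ℝ => (x + q.1 • q.2.1, q.2.2.1)) q h
      (by fun_prop)
  unfold polarIntegrand
  refine ContDiffAt.mul (hF.contDiffAt.comp q ?_) (by fun_prop)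
  fun_prop

/-- At points of the domain, the Radon transform of a smooth cutoff is smooth in the first
variable, with bounds that are uniform in the direction. -/
theorem exists_radonScalar_regularity {D : Set E3} (hD : IsSmoothConvexDomain D) {F g : E3 → ℝ}
    (hg : IsSmoothCutoff D F g) {x : E3} (hx : x ∈ D) :
    ∃ δ > 0, Metric.ball x δ ⊆ D ∧ ∀ k : ℕ, ∃ C, ∀ η : E3, ‖η‖ = 1 → ∀ t, |t| < δ →
      HasDerivAt (iteratedDeriv k (radonScalar g η))
        (iteratedDeriv (k + 1) (radonScalar g η) (inner ℝ η x + t)) (inner ℝ η x + t) ∧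
      |iteratedDeriv k (radonScalar g η) (inner ℝ η x + t)| ≤ C := by
  obtain ⟨δ, hδ, hball⟩ := Metric.nhds_basis_closedBall.mem_iff.1 (hD.isOpen.mem_nhds hx)
  set O : Set (ℝ × E3 × E3 × ℝ) := {q | x + q.1 • q.2.1 ∈ D ∧ q.2.2.1 ≠ 0} with hOdef
  have hO : IsOpen O :=
    (hD.isOpen.preimage (by fun_prop : Continuous fun q : ℝ × E3 × E3 × ℝ =>
      x + q.1 • q.2.1)).inter (isOpen_ne.preimage (by fun_prop : Continuous
        fun q : ℝ × E3 × E3 × ℝ => q.2.2.1))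
  set Ψ : ℝ × E3 × E3 × ℝ → ℝ := fun q => polarIntegrand D F (x + q.1 • q.2.1) q.2.2.1 q.2.2.2
    with hΨdef
  have hΨ : ContDiffOn ℝ ∞ Ψ O := fun q hq =>
    (contDiffAt_polarIntegrand hD hg.contDiff x hq.1 hq.2).contDiffWithinAt
  -- The parameters are the direction `η`, the unit vector `v` along a ray and the rescaled radius
  -- `s`. Orthogonality of `η` and `v` is not imposed; the product of the two spheres is already
  -- compact.
  set K : Set (E3 × E3 × ℝ) := Metric.sphere 0 1 ×ˢ Metric.sphere 0 1 ×ˢ Set.Icc 0 1 with hKdef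
  have hK : IsCompact K := (isCompact_sphere _ _).prod ((isCompact_sphere _ _).prod isCompact_Icc)
  have hline : ∀ η : E3, ‖η‖ = 1 → ∀ t, |t| ≤ δ → x + t • η ∈ D := by
    intro η hη t ht
    apply hball
    rw [Metric.mem_closedBall, dist_eq_norm, add_sub_cancel_left, norm_smul, hη, mul_one]
    exact ht
  have hKO : Set.Icc (-δ) δ ×ˢ K ⊆ O := by
    rintro ⟨t, η, v, s⟩ ⟨ht, hη, hv, hs⟩
    refine ⟨hline η (by simpa using hη) t (abs_le.2 ht), ?_⟩
    rw [← norm_pos_iff]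
    have : ‖v‖ = 1 := by simpa using hv
    rw [this]; exact one_pos
  set A : Set (ℝ × ℝ) := Set.Ioo (-Real.pi) Real.pi ×ˢ Set.Ioo 0 1 with hAdef
  have hA : MeasurableSet A := measurableSet_Ioo.prod measurableSet_Ioo
  have hμ : (volume : Measure (ℝ × ℝ)) A ≠ ⊤ := by
    rw [Measure.volume_eq_prod, Measure.prod_prod]
    exact (ENNReal.mul_lt_top (by simp) (by simp)).ne
  have hmain := fun k => exists_hasDerivAt_integral_timeDeriv hO hΨ hK hKO volume hA hμ k
  choose C hC using hmain
  refine ⟨δ, hδ, Metric.ball_subset_closedBall.trans hball, fun k => ⟨C k, fun η hη => ?_⟩⟩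
  obtain ⟨b, rfl⟩ := exists_orthonormalBasis_zero_eq hη
  set γ : ℝ × ℝ → E3 × E3 × ℝ := fun w => (b 0, circleVec (b 1) (b 2) w.1, w.2) with hγdef
  have hγ : Continuous γ := by
    have := continuous_circleVec (b 1) (b 2)
    fun_prop
  have hγK : Set.MapsTo γ A K := fun w hw =>
    ⟨mem_sphere_zero_iff_norm.2 hη, mem_sphere_zero_iff_norm.2 (norm_circleVec b w.1),
    Set.Ioo_subset_Icc_self hw.2⟩
  have hder := fun k t ht => hC k γ hγ.continuousOn hγK t ht
  set a := inner ℝ (b 0) x with ha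
  have hself : inner ℝ (b 0) (b 0) = (1 : ℝ) := by
    rw [real_inner_self_eq_norm_sq, hη, one_pow]
  -- The formula must hold on a whole interval of `t` at each order, so that it can be
  -- differentiated again to reach the next order.
  have heq : ∀ k, ∀ t, |t| < δ → iteratedDeriv k (radonScalar g (b 0)) (a + t) =
      ∫ w in A, timeDeriv Ψ k (t, γ w) := by
    intro k
    induction k with
    | zero =>
      intro t ht
      have := radonScalar_eq_integral_polar hD hg b (hline (b 0) hη t ht.le)
      rw [inner_add_right, inner_smul_right, hself, mul_one] at this
      rw [iteratedDeriv_zero, this]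
      rfl
    | succ k ih =>
      intro t ht
      have hev : (fun s => iteratedDeriv k (radonScalar g (b 0)) (a + s)) =ᶠ[𝓝 t]
          fun s => ∫ w in A, timeDeriv Ψ k (s, γ w) := by
        filter_upwards [Ioo_mem_nhds (abs_lt.1 ht).1 (abs_lt.1 ht).2] with s hs
        exact ih s (abs_lt.2 hs)
      rw [iteratedDeriv_succ, ← (hder k t ht).1.deriv, ← hev.deriv_eq, deriv_comp_const_add]
  intro t ht
  have hev : (fun s => iteratedDeriv k (radonScalar g (b 0)) (a + s)) =ᶠ[𝓝 t]
      fun s => ∫ w in A, timeDeriv Ψ k (s, γ w) := by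
    filter_upwards [Ioo_mem_nhds (abs_lt.1 ht).1 (abs_lt.1 ht).2] with s hs
    exact heq k s (abs_lt.2 hs)
  rw [heq k t ht, heq (k + 1) t ht]
  refine ⟨?_, (hder k t ht).2⟩
  have h1 := (hder k t ht).1.congr_of_eventuallyEq hev
  have h2 : HasDerivAt (fun y : ℝ => y - a) 1 (a + t) := (hasDerivAt_id _).sub_const a
  have h3 := HasDerivAt.comp (a + t) (h₂ := fun s => iteratedDeriv k (radonScalar g (b 0)) (a + s))
    (h := fun y : ℝ => y - a) (by rwa [add_sub_cancel_left]) h2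
  simpa [Function.comp_def] using h3

/-! ### Volumes of cones and the area of a spherical zone -/

theorem volume_disc {R : ℝ} (hR : 0 ≤ R) :
    volume {q : ℝ × ℝ | q.1 ^ 2 + q.2 ^ 2 < R} = ENNReal.ofReal (Real.pi * R) := by
  rw [← Complex.volume_preserving_equiv_real_prod.measure_preimage_equiv]
  have : Complex.measurableEquivRealProd ⁻¹' {q : ℝ × ℝ | q.1 ^ 2 + q.2 ^ 2 < R} =
      Metric.ball 0 (√R) := by
    ext z
    rw [Set.mem_preimage, mem_ball_zero_iff, Real.lt_sqrt (norm_nonneg _), Complex.sq_norm,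
      Complex.normSq_apply]
    simp [Complex.measurableEquivRealProd_apply, sq]
  rw [this, Complex.volume_ball, ← ENNReal.ofReal_pow (Real.sqrt_nonneg _), Real.sq_sqrt hR,
    ← ENNReal.ofReal_coe_nnreal, ← ENNReal.ofReal_mul hR, mul_comm, NNReal.coe_real_pi]

theorem volume_closedDisc {R : ℝ} (hR : 0 ≤ R) :
    volume {q : ℝ × ℝ | q.1 ^ 2 + q.2 ^ 2 ≤ R} = ENNReal.ofReal (Real.pi * R) := by
  rw [← Complex.volume_preserving_equiv_real_prod.measure_preimage_equiv]
  have : Complex.measurableEquivRealProd ⁻¹' {q : ℝ × ℝ | q.1 ^ 2 + q.2 ^ 2 ≤ R} =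
      Metric.closedBall 0 (√R) := by
    ext z
    rw [Set.mem_preimage, mem_closedBall_zero_iff, Real.le_sqrt (norm_nonneg _) hR, Complex.sq_norm,
      Complex.normSq_apply]
    simp [Complex.measurableEquivRealProd_apply, sq]
  rw [this, Complex.volume_closedBall, ← ENNReal.ofReal_pow (Real.sqrt_nonneg _), Real.sq_sqrt hR,
    ← ENNReal.ofReal_coe_nnreal, ← ENNReal.ofReal_mul hR, mul_comm, NNReal.coe_real_pi]

theorem volume_annulus {R R' : ℝ} (hR' : 0 ≤ R') (h : R' ≤ R) :
    volume {q : ℝ × ℝ | R' < q.1 ^ 2 + q.2 ^ 2 ∧ q.1 ^ 2 + q.2 ^ 2 < R} =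
      ENNReal.ofReal (Real.pi * (R - R')) := by
  rcases h.eq_or_lt with rfl | h
  · have : {q : ℝ × ℝ | R' < q.1 ^ 2 + q.2 ^ 2 ∧ q.1 ^ 2 + q.2 ^ 2 < R'} = ∅ := by
      ext q
      simp only [Set.mem_ofPred_eq, Set.mem_empty_iff_false, iff_false]
      exact fun hq => lt_asymm hq.1 hq.2
    simp [this]
  have : {q : ℝ × ℝ | R' < q.1 ^ 2 + q.2 ^ 2 ∧ q.1 ^ 2 + q.2 ^ 2 < R} =
      {q : ℝ × ℝ | q.1 ^ 2 + q.2 ^ 2 < R} \ {q : ℝ × ℝ | q.1 ^ 2 + q.2 ^ 2 ≤ R'} := by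
    ext q
    simp only [Set.mem_ofPred_eq, Set.mem_sdiff, not_le]
    exact and_comm
  rw [this, measure_sdiff, volume_disc (hR'.trans h.le), volume_closedDisc hR',
    ← ENNReal.ofReal_sub _ (by positivity), mul_sub]
  · exact fun q hq => lt_of_le_of_lt (show q.1 ^ 2 + q.2 ^ 2 ≤ R' from hq) h
  · exact (measurableSet_le (by fun_prop) (by fun_prop)).nullMeasurableSet
  · rw [volume_closedDisc hR']; exact ENNReal.ofReal_ne_top

/-- The volume of the part of the unit ball that is cut out by the double cone around the plane
orthogonal to a unit vector. -/
theorem volume_cone {u : E3} (hu : ‖u‖ = 1) {s : ℝ} (hs : 0 < s) (hs1 : s ≤ 1) :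
    volume {y : E3 | 0 < ‖y‖ ∧ ‖y‖ < 1 ∧ |inner ℝ u y| < s * ‖y‖} =
      ENNReal.ofReal (4 * Real.pi * s / 3) := by
  obtain ⟨b, rfl⟩ := exists_orthonormalBasis_zero_eq hu
  rw [← (measurePreserving_frameEquiv b).measure_preimage_equiv]
  -- With `‖y‖² = p² + x² + y²`, the condition `|p| < s‖y‖` becomes `c p² < x² + y²`. The slice at
  -- height `p` is therefore an annulus of area `π (1 - p²/s²)`, empty for `|p| > s`.
  set c : ℝ := 1 / s ^ 2 - 1 with hc
  have hc0 : 0 ≤ c := by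
    rw [hc, sub_nonneg, le_div_iff₀ (by positivity), one_mul]
    exact pow_le_one₀ hs.le hs1
  have hset : frameEquiv b ⁻¹' {y : E3 | 0 < ‖y‖ ∧ ‖y‖ < 1 ∧ |inner ℝ (b 0) y| < s * ‖y‖} =
      {q : ℝ × ℝ × ℝ | c * q.1 ^ 2 < q.2.1 ^ 2 + q.2.2 ^ 2 ∧
        q.2.1 ^ 2 + q.2.2 ^ 2 < 1 - q.1 ^ 2} := by
    ext ⟨p, x, y⟩
    have hn := norm_frame_sq b p x y
    simp only [Set.mem_preimage, Set.mem_ofPred_eq, frameEquiv_apply, inner_frame]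
    set N := ‖p • b 0 + (x • b 1 + y • b 2)‖
    have hN : 0 ≤ N := norm_nonneg _
    have h1 : |p| < s * N ↔ c * p ^ 2 < x ^ 2 + y ^ 2 := by
      rw [← abs_of_nonneg (mul_nonneg hs.le hN), ← sq_lt_sq, mul_pow, hn, hc]
      have : (1 / s ^ 2 - 1) * p ^ 2 = p ^ 2 / s ^ 2 - p ^ 2 := by ring
      rw [this, sub_lt_iff_lt_add, div_lt_iff₀ (by positivity)]
      constructor <;> intro h <;> linarith
    have h2 : N < 1 ↔ x ^ 2 + y ^ 2 < 1 - p ^ 2 := by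
      rw [← sq_lt_one_iff₀ hN, hn]
      constructor <;> intro h <;> linarith
    rw [h1, h2]
    constructor
    · rintro ⟨-, h3, h4⟩
      exact ⟨h4, h3⟩
    · rintro ⟨h3, h4⟩
      refine ⟨?_, h4, h3⟩
      have h5 : |p| < s * N := h1.2 h3
      exact pos_of_mul_pos_right ((abs_nonneg p).trans_lt h5) hs.le
  have hmeas : MeasurableSet {q : ℝ × ℝ × ℝ | c * q.1 ^ 2 < q.2.1 ^ 2 + q.2.2 ^ 2 ∧
        q.2.1 ^ 2 + q.2.2 ^ 2 < 1 - q.1 ^ 2} := by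
    refine MeasurableSet.inter (s₁ := {q : ℝ × ℝ × ℝ | c * q.1 ^ 2 < q.2.1 ^ 2 + q.2.2 ^ 2})
      (s₂ := {q : ℝ × ℝ × ℝ | q.2.1 ^ 2 + q.2.2 ^ 2 < 1 - q.1 ^ 2}) ?_ ?_
    · exact measurableSet_lt (by fun_prop) (by fun_prop)
    · exact measurableSet_lt (by fun_prop) (by fun_prop)
  rw [hset, Measure.volume_eq_prod, Measure.prod_apply hmeas]
  have hc1 : ∀ p : ℝ, 1 - p ^ 2 - c * p ^ 2 = 1 - p ^ 2 / s ^ 2 := fun p => by rw [hc]; ring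
  have hslice : ∀ p : ℝ, volume (Prod.mk p ⁻¹' {q : ℝ × ℝ × ℝ |
      c * q.1 ^ 2 < q.2.1 ^ 2 + q.2.2 ^ 2 ∧ q.2.1 ^ 2 + q.2.2 ^ 2 < 1 - q.1 ^ 2}) =
      (Set.Ioc (-s) s).indicator (fun p => ENNReal.ofReal (Real.pi * (1 - p ^ 2 / s ^ 2))) p := by
    intro p
    simp only [Set.preimage_ofPred_eq]
    by_cases hp : p ^ 2 ≤ s ^ 2
    · have hle : c * p ^ 2 ≤ 1 - p ^ 2 := by
        have := (div_le_one (by positivity : 0 < s ^ 2)).2 hp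
        linarith [hc1 p]
      rw [volume_annulus (by positivity) hle]
      by_cases hp2 : p ∈ Set.Ioc (-s) s
      · rw [Set.indicator_of_mem hp2, hc1 p]
      -- The half-open interval, convenient for interval integrals, omits `p = -s`, where the
      -- annulus has area zero anyway.
      · have : p = -s := by
          have h1 := abs_le_of_sq_le_sq' hp hs.le
          by_contra hne
          exact hp2 ⟨lt_of_le_of_ne h1.1 (Ne.symm hne), h1.2⟩
        rw [Set.indicator_of_notMem hp2, hc1 p, this, neg_sq, div_self (by positivity)]
        simp
    · rw [Set.indicator_of_notMem]
      · have : {q : ℝ × ℝ | c * p ^ 2 < q.1 ^ 2 + q.2 ^ 2 ∧ q.1 ^ 2 + q.2 ^ 2 < 1 - p ^ 2} = ∅ := by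
          ext q
          simp only [Set.mem_ofPred_eq, Set.mem_empty_iff_false, iff_false]
          rintro ⟨h1, h2⟩
          have := (one_lt_div (by positivity : 0 < s ^ 2)).2 (not_le.1 hp)
          linarith [hc1 p]
        rw [this, measure_empty]
      · intro h
        exact hp (sq_le_sq' h.1.le h.2)
  simp_rw [hslice]
  rw [lintegral_indicator measurableSet_Ioc, ← ofReal_integral_eq_lintegral_ofReal]
  · rw [← intervalIntegral.integral_of_le (by linarith)]
    congr 1
    have : ∫ p in (-s)..s, Real.pi * (1 - p ^ 2 / s ^ 2) =
        Real.pi * ((s - -s) - ((s ^ 3 - (-s) ^ 3) / 3) / s ^ 2) := by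
      rw [intervalIntegral.integral_const_mul, intervalIntegral.integral_sub (by simp)
        (Continuous.intervalIntegrable (by fun_prop) _ _), intervalIntegral.integral_div,
        integral_pow]
      simp
      norm_num
    rw [this]
    field_simp
    ring
  · exact (Continuous.integrableOn_Icc (by fun_prop)).mono_set Set.Ioc_subset_Icc_self
  · refine ae_restrict_of_forall_mem measurableSet_Ioc fun p hp => ?_
    have := (div_le_one (by positivity : 0 < s ^ 2)).2 (sq_le_sq' hp.1.le hp.2)
    have hpi := Real.pi_pos
    exact mul_nonneg hpi.le (by linarith)

instance : IsFiniteMeasure surfaceMeasure := by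
  unfold surfaceMeasure; infer_instance

theorem surfaceMeasure_real_univ : surfaceMeasure.real Set.univ = 4 * Real.pi := by
  rw [surfaceMeasure, Measure.toSphere_real_apply_univ, measureReal_def,
    EuclideanSpace.volume_ball_fin_three]
  rw [ENNReal.ofReal_one, one_pow, one_mul, ENNReal.toReal_ofReal (by positivity)]
  simp
  ring

open scoped Pointwise in
/-- Archimedes' theorem on the area of a spherical zone. -/
theorem surfaceMeasure_real_zone {w : E3} (hw : w ≠ 0) {ε : ℝ} (hε : 0 < ε) :
    surfaceMeasure.real {η : S2 | |inner ℝ (η : E3) w| < ε} =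
      4 * Real.pi * min 1 (ε / ‖w‖) := by
  have hwn : 0 < ‖w‖ := norm_pos_iff.2 hw
  rcases le_or_gt (ε / ‖w‖) 1 with h | h
  · rw [min_eq_right h]
    set s := ε / ‖w‖ with hs
    have hs0 : 0 < s := by positivity
    set u : E3 := ‖w‖⁻¹ • w with hu
    have hun : ‖u‖ = 1 := by rw [hu, norm_smul, norm_inv, norm_norm, inv_mul_cancel₀ hwn.ne']
    have hwu : w = ‖w‖ • u := by rw [hu, smul_smul, mul_inv_cancel₀ hwn.ne', one_smul]
    have hiff : ∀ η : E3, |inner ℝ η w| < ε ↔ |inner ℝ u η| < s := by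
      intro η
      rw [hs, lt_div_iff₀ hwn]
      conv_lhs => rw [hwu, inner_smul_right, abs_mul, abs_of_pos hwn, mul_comm, real_inner_comm]
    have hmeas : MeasurableSet {η : S2 | |inner ℝ (η : E3) w| < ε} :=
      measurableSet_lt (by fun_prop) measurable_const
    have hcone : (Set.Ioo (0 : ℝ) 1 • (Subtype.val '' {η : S2 | |inner ℝ (η : E3) w| < ε}) :
        Set E3) = {y : E3 | 0 < ‖y‖ ∧ ‖y‖ < 1 ∧ |inner ℝ u y| < s * ‖y‖} := by
      ext y
      rw [Set.mem_smul]
      constructor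
      · rintro ⟨r, hr, _, ⟨η, hη, rfl⟩, rfl⟩
        have hη1 : ‖(η : E3)‖ = 1 := mem_sphere_zero_iff_norm.1 η.2
        have h1 : ‖r • (η : E3)‖ = r := by
          rw [norm_smul, hη1, mul_one, Real.norm_of_nonneg hr.1.le]
        refine ⟨by rw [h1]; exact hr.1, by rw [h1]; exact hr.2, ?_⟩
        rw [h1, inner_smul_right, abs_mul, abs_of_pos hr.1, mul_comm]
        exact mul_lt_mul_of_pos_right ((hiff _).1 hη) hr.1
      · rintro ⟨h0, h1, h2⟩
        refine ⟨‖y‖, ⟨h0, h1⟩, ‖y‖⁻¹ • y, ⟨⟨‖y‖⁻¹ • y, ?_⟩, ?_, rfl⟩, ?_⟩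
        · rw [mem_sphere_zero_iff_norm, norm_smul, norm_inv, norm_norm, inv_mul_cancel₀ h0.ne']
        · refine (hiff _).2 ?_
          rw [inner_smul_right, abs_mul, abs_of_pos (inv_pos.2 h0), inv_mul_lt_iff₀ h0, mul_comm]
          exact h2
        · simp only [smul_smul, mul_inv_cancel₀ h0.ne', one_smul]
    -- The surface measure of a set is three times the volume of the cone over it, which turns
    -- `4πs/3` into `4πs`.
    rw [measureReal_def, surfaceMeasure, Measure.toSphere_apply' _ hmeas, hcone,
      volume_cone hun hs0 h, ENNReal.toReal_mul, ENNReal.toReal_ofReal (by positivity)]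
    simp
    ring
  · rw [min_eq_left h.le, mul_one, ← surfaceMeasure_real_univ]
    congr 1
    ext η
    simp only [Set.mem_ofPred_eq, Set.mem_univ, iff_true]
    have h1 := abs_real_inner_le_norm (η : E3) w
    rw [mem_sphere_zero_iff_norm.1 η.2, one_mul] at h1
    rw [one_lt_div hwn] at h
    exact h1.trans_lt h

/-! ### Slab integrals and Taylor expansion of the Radon transform -/

theorem norm_coe_S2 (η : S2) : ‖(η : E3)‖ = 1 := mem_sphere_zero_iff_norm.1 η.2

/-- The integral of `g` over the slab of half width `ε` around a plane. -/
noncomputable def slabIntegral (g : E3 → ℝ) (ε : ℝ) (η : E3) (p : ℝ) : ℝ :=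
  ∫ y, (Set.Ioo (p - ε) (p + ε)).indicator (fun _ => (1 : ℝ)) (inner ℝ η y) * g y

theorem integrable_indicator_mul {g : E3 → ℝ} (hg : Integrable g) {s : Set ℝ}
    (hs : MeasurableSet s) (η : E3) :
    Integrable fun y => s.indicator (fun _ => (1 : ℝ)) (inner ℝ η y) * g y := by
  refine hg.bdd_mul (c := 1) ?_ (Eventually.of_forall fun y => ?_)
  · exact ((measurable_const.indicator hs).comp (by fun_prop)).aestronglyMeasurable
  · refine (norm_indicator_le_norm_self _ _).trans ?_
    simp

theorem slabIntegral_eq {g : E3 → ℝ} (hg : Integrable g) {ε : ℝ} (hε : 0 ≤ ε) {η : E3}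
    (hη : ‖η‖ = 1) (p : ℝ) :
    slabIntegral g ε η p = ∫ q in (p - ε)..(p + ε), radonScalar g η q := by
  rw [slabIntegral, integral_planeWave_mul hη (integrable_indicator_mul hg measurableSet_Ioo η),
    intervalIntegral.integral_of_le (by linarith), integral_Ioc_eq_integral_Ioo,
    ← integral_indicator measurableSet_Ioo]
  congr 1
  ext q
  simp [Set.indicator_apply]

theorem measurable_slabIntegral {g : E3 → ℝ} (hg : Measurable g) (ε : ℝ) {p : S2 → ℝ}
    (hp : Measurable p) : Measurable fun η : S2 => slabIntegral g ε η (p η) := by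
  -- Recentring the slab puts the dependence on `η` inside the argument of a fixed indicator, which
  -- makes joint measurability visible.
  have h : Measurable fun q : S2 × E3 =>
      (Set.Ioo (-ε) ε).indicator (fun _ => (1 : ℝ)) (inner ℝ (q.1 : E3) q.2 - p q.1) * g q.2 := by
    have h1 : Measurable ((Set.Ioo (-ε) ε).indicator (fun _ => (1 : ℝ))) :=
      measurable_const.indicator measurableSet_Ioo
    have h2 : Measurable fun q : S2 × E3 => inner ℝ (q.1 : E3) q.2 :=
      (by fun_prop : Continuous fun q : S2 × E3 => inner ℝ (q.1 : E3) q.2).measurable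
    exact (h1.comp (h2.sub (hp.comp measurable_fst))).mul (hg.comp measurable_snd)
  have h2 : (fun η : S2 => slabIntegral g ε η (p η)) = fun η : S2 => ∫ y,
      (Set.Ioo (-ε) ε).indicator (fun _ => (1 : ℝ)) (inner ℝ (η : E3) y - p η) * g y := by
    ext η
    unfold slabIntegral
    congr 1
    ext y
    congr 1
    simp only [Set.indicator_apply, Set.mem_Ioo]
    congr 1
    apply propext
    constructor <;> rintro ⟨h1, h2⟩ <;> constructor <;> linarith
  rw [h2]
  exact h.stronglyMeasurable.integral_prod_right.measurable

/-- The mean value inequality on the segment from `0` to `t`. It raises the order of a remainder by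
one; the constant is not sharp, lacking the factor `1/(k+1)`. -/
theorem abs_le_mul_pow_succ_of_hasDerivAt {e e' : ℝ → ℝ} {δ C : ℝ} {k : ℕ} (hC : 0 ≤ C)
    (h0 : e 0 = 0) (hd : ∀ t, |t| < δ → HasDerivAt e (e' t) t)
    (hb : ∀ t, |t| < δ → |e' t| ≤ C * |t| ^ k) {t : ℝ} (ht : |t| < δ) :
    |e t| ≤ C * |t| ^ (k + 1) := by
  have hseg : ∀ s ∈ Set.uIcc 0 t, |s| ≤ |t| := by
    intro s hs
    simpa using Set.abs_sub_left_of_mem_uIcc hs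
  have h := (convex_uIcc 0 t).norm_image_sub_le_of_norm_hasDerivWithin_le (f := e) (f' := e')
    (C := C * |t| ^ k) (fun s hs => (hd s ((hseg s hs).trans_lt ht)).hasDerivWithinAt)
    (fun s hs => (hb s ((hseg s hs).trans_lt ht)).trans
      (mul_le_mul_of_nonneg_left (pow_le_pow_left₀ (abs_nonneg s) (hseg s hs) k) hC))
    Set.left_mem_uIcc Set.right_mem_uIcc
  rw [h0, sub_zero, sub_zero, Real.norm_eq_abs, Real.norm_eq_abs] at h
  rw [pow_succ, ← mul_assoc]
  exact h

/-- The linear term is odd and integrates to zero, while `t²` contributes `2ε³/3`. The remainder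
order `k` is left free: `k = 3` serves the inversion formula, and `k = 1` with `A = B = 0` serves
measurability. -/
theorem abs_integral_slab_sub_le {r : ℝ → ℝ} {a ε δ C A B : ℝ} (hε : 0 < ε) (hεδ : ε < δ)
    (hC : 0 ≤ C) (hcont : ∀ t, |t| < δ → ContinuousAt r (a + t)) {k : ℕ}
    (h : ∀ t, |t| < δ → |r (a + t) - (r a + A * t + B * t ^ 2)| ≤ C * |t| ^ k) :
    |(∫ q in (a - ε)..(a + ε), r q) - (2 * ε * r a + 2 / 3 * B * ε ^ 3)| ≤ 2 * C * ε ^ (k + 1) := by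
  have hshift : ∫ q in (a - ε)..(a + ε), r q = ∫ t in (-ε)..ε, r (a + t) := by
    rw [intervalIntegral.integral_comp_add_left]
    congr 1
  have hle : ∀ t ∈ Set.Icc (-ε) ε, |t| < δ := fun t ht => (abs_le.2 ht).trans_lt hεδ
  have hint : IntervalIntegrable (fun t => r (a + t)) volume (-ε) ε := by
    refine ContinuousOn.intervalIntegrable fun t ht => ?_
    rw [Set.uIcc_of_le (by linarith)] at ht
    have h1 : ContinuousAt (fun t => r (a + t)) t :=
      ContinuousAt.comp (f := fun t => a + t) (hcont t (hle t ht)) (by fun_prop)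
    exact h1.continuousWithinAt
  have hpoly : ∫ t in (-ε)..ε, (r a + A * t + B * t ^ 2) = 2 * ε * r a + 2 / 3 * B * ε ^ 3 := by
    rw [intervalIntegral.integral_add (Continuous.intervalIntegrable (by fun_prop) _ _)
      (Continuous.intervalIntegrable (by fun_prop) _ _),
      intervalIntegral.integral_add (Continuous.intervalIntegrable (by fun_prop) _ _)
      (Continuous.intervalIntegrable (by fun_prop) _ _), intervalIntegral.integral_const_mul,
      intervalIntegral.integral_const_mul, integral_pow, integral_id,
      intervalIntegral.integral_const]
    simp only [smul_eq_mul]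
    norm_num
    ring
  rw [hshift, ← hpoly, ← intervalIntegral.integral_sub hint
    (Continuous.intervalIntegrable (by fun_prop) _ _)]
  have := intervalIntegral.norm_integral_le_of_norm_le_const (a := -ε) (b := ε)
    (C := C * ε ^ k) (f := fun t => r (a + t) - (r a + A * t + B * t ^ 2)) fun t ht => by
      rw [Set.uIoc_of_le (by linarith)] at ht
      have ht' := Set.Ioc_subset_Icc_self ht
      exact (h t (hle t ht')).trans (mul_le_mul_of_nonneg_left
        (pow_le_pow_left₀ (abs_nonneg t) (abs_le.2 ht') k) hC)
  rw [Real.norm_eq_abs] at this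
  refine this.trans (le_of_eq ?_)
  rw [abs_of_pos (by linarith)]
  ring

/-- The hypotheses on a scalar field near a point under which its Radon transform can be
differentiated there, uniformly in the direction. -/
structure IsRadonRegularAt (g : E3 → ℝ) (x : E3) (δ : ℝ) : Prop where
  pos : 0 < δ
  hasDerivAt : ∀ (k : ℕ) (η : S2) (t : ℝ), |t| < δ →
    HasDerivAt (iteratedDeriv k (radonScalar g η))
      (iteratedDeriv (k + 1) (radonScalar g η) (inner ℝ (η : E3) x + t)) (inner ℝ (η : E3) x + t)
  bound : ∀ k : ℕ, ∃ C, 0 ≤ C ∧ ∀ (η : S2) (t : ℝ), |t| < δ →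
    |iteratedDeriv k (radonScalar g η) (inner ℝ (η : E3) x + t)| ≤ C

theorem exists_isRadonRegularAt {D : Set E3} (hD : IsSmoothConvexDomain D) {F g : E3 → ℝ}
    (hg : IsSmoothCutoff D F g) {x : E3} (hx : x ∈ D) :
    ∃ δ, Metric.ball x δ ⊆ D ∧ IsRadonRegularAt g x δ := by
  obtain ⟨δ, hδ, hball, h⟩ := exists_radonScalar_regularity hD hg hx
  refine ⟨δ, hball, hδ, fun k η t ht => ?_, fun k => ?_⟩
  · obtain ⟨C, hC⟩ := h k
    exact (hC η (norm_coe_S2 η) t ht).1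
  · obtain ⟨C, hC⟩ := h k
    have hC' := fun (η : S2) t ht => (hC η (norm_coe_S2 η) t ht).2
    refine ⟨max C 0, le_max_right _ _, fun η t ht => (hC' η t ht).trans (le_max_left _ _)⟩

namespace IsRadonRegularAt

variable {g : E3 → ℝ} {x : E3} {δ : ℝ}

theorem hasDerivAt_shift (h : IsRadonRegularAt g x δ) (k : ℕ) (η : S2) {t : ℝ} (ht : |t| < δ) :
    HasDerivAt (fun t => iteratedDeriv k (radonScalar g η) (inner ℝ (η : E3) x + t))
      (iteratedDeriv (k + 1) (radonScalar g η) (inner ℝ (η : E3) x + t)) t :=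
  (h.hasDerivAt k η t ht).comp_const_add _ _

theorem abs_taylor_zero (h : IsRadonRegularAt g x δ) (k : ℕ) : ∃ C, 0 ≤ C ∧
    ∀ (η : S2) (t : ℝ), |t| < δ → |iteratedDeriv k (radonScalar g η) (inner ℝ (η : E3) x + t) -
      iteratedDeriv k (radonScalar g η) (inner ℝ (η : E3) x)| ≤ C * |t| ^ 1 := by
  obtain ⟨C, hC0, hC⟩ := h.bound (k + 1)
  refine ⟨C, hC0, fun η t ht => ?_⟩
  refine abs_le_mul_pow_succ_of_hasDerivAt (k := 0)
    (e := fun t => iteratedDeriv k (radonScalar g η) (inner ℝ (η : E3) x + t) -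
      iteratedDeriv k (radonScalar g η) (inner ℝ (η : E3) x)) hC0 (by simp)
    (fun s hs => (h.hasDerivAt_shift k η hs).sub_const _) (fun s hs => ?_) ht
  simpa using hC η s hs

/-- A Lipschitz bound for the second derivative, integrated twice; the constant is the uniform bound
on the third derivative. -/
theorem abs_taylor_two (h : IsRadonRegularAt g x δ) : ∃ C, 0 ≤ C ∧
    ∀ (η : S2) (t : ℝ), |t| < δ → |radonScalar g η (inner ℝ (η : E3) x + t) -
      (radonScalar g η (inner ℝ (η : E3) x) +
        iteratedDeriv 1 (radonScalar g η) (inner ℝ (η : E3) x) * t +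
        iteratedDeriv 2 (radonScalar g η) (inner ℝ (η : E3) x) / 2 * t ^ 2)| ≤ C * |t| ^ 3 := by
  obtain ⟨C, hC0, hC⟩ := h.abs_taylor_zero 2
  refine ⟨C, hC0, fun η t ht => ?_⟩
  set a := inner ℝ (η : E3) x
  set r := radonScalar g η
  have h1 : ∀ t, |t| < δ → |iteratedDeriv 1 r (a + t) -
      (iteratedDeriv 1 r a + iteratedDeriv 2 r a * t)| ≤ C * |t| ^ 2 := by
    intro t ht
    refine abs_le_mul_pow_succ_of_hasDerivAt (k := 1) (e := fun t => iteratedDeriv 1 r (a + t) -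
      (iteratedDeriv 1 r a + iteratedDeriv 2 r a * t))
      (e' := fun t => iteratedDeriv 2 r (a + t) - iteratedDeriv 2 r a) hC0 (by simp)
      (fun s hs => ?_) (fun s hs => hC η s hs) ht
    have := (h.hasDerivAt_shift 1 η hs).sub
      (((hasDerivAt_id s).const_mul (iteratedDeriv 2 r a)).const_add (iteratedDeriv 1 r a))
    exact this.congr_deriv (by simp [a, r])
  refine abs_le_mul_pow_succ_of_hasDerivAt (k := 2) (e := fun t => r (a + t) -
      (r a + iteratedDeriv 1 r a * t + iteratedDeriv 2 r a / 2 * t ^ 2))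
      (e' := fun t => iteratedDeriv 1 r (a + t) -
      (iteratedDeriv 1 r a + iteratedDeriv 2 r a * t)) hC0 (by simp)
      (fun s hs => ?_) (fun s hs => h1 s hs) ht
  have h2 := h.hasDerivAt_shift 0 η hs
  rw [iteratedDeriv_zero] at h2
  have h3 : HasDerivAt (fun t : ℝ => r a + iteratedDeriv 1 r a * t +
      iteratedDeriv 2 r a / 2 * t ^ 2) (iteratedDeriv 1 r a + iteratedDeriv 2 r a * s) s := by
    have := (((hasDerivAt_id s).const_mul (iteratedDeriv 1 r a)).const_add (r a)).add
      ((hasDerivAt_pow 2 s).const_mul (iteratedDeriv 2 r a / 2))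
    refine this.congr_deriv ?_
    simp
    ring
  exact h2.sub h3

theorem continuousAt (h : IsRadonRegularAt g x δ) (η : S2) {t : ℝ} (ht : |t| < δ) :
    ContinuousAt (radonScalar g η) (inner ℝ (η : E3) x + t) := by
  simpa using (h.hasDerivAt 0 η t ht).continuousAt

/-- The polar representation uses a frame picked separately for each `η`, so it gives no
measurability in `η`. Instead the transform is a pointwise limit of normalised slab integrals, which
are measurable by Fubini, and each further derivative is a limit of difference quotients. -/
theorem measurable_iteratedDeriv (h : IsRadonRegularAt g x δ) (hg : Integrable g)
    (hgm : Measurable g) (k : ℕ) {t : ℝ} (ht : |t| < δ) :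
    Measurable fun η : S2 => iteratedDeriv k (radonScalar g η) (inner ℝ (η : E3) x + t) := by
  have hlim : Tendsto (fun n : ℕ => 1 / ((n : ℝ) + 1)) atTop (𝓝 0) :=
    tendsto_one_div_add_atTop_nhds_zero_nat
  have hpos : ∀ n : ℕ, 0 < 1 / ((n : ℝ) + 1) := fun n => by positivity
  induction k generalizing t with
  | zero =>
    refine measurable_of_tendsto_metrizable (f := fun (n : ℕ) (η : S2) =>
      (1 / ((n : ℝ) + 1))⁻¹ * ((1 / 2) * slabIntegral g (1 / ((n : ℝ) + 1)) η
        (inner ℝ (η : E3) x + t)))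
      (fun n => ?_) ?_
    · exact ((measurable_slabIntegral hgm _
        (by fun_prop : Measurable fun η : S2 => inner ℝ (η : E3) x + t)).const_mul _).const_mul _
    · rw [tendsto_pi_nhds]
      intro η
      rw [iteratedDeriv_zero]
      set r := radonScalar g η
      set a := inner ℝ (η : E3) x
      obtain ⟨C, hC0, hC⟩ := h.bound 1
      have hδ' : 0 < δ - |t| := sub_pos.2 ht
      have hlt : ∀ s, |s| < δ - |t| → |t + s| < δ := fun s hs =>
        (abs_add_le t s).trans_lt (by linarith)
      have htay : ∀ s, |s| < δ - |t| →
          |r (a + t + s) - (r (a + t) + 0 * s + 0 * s ^ 2)| ≤ C * |s| ^ 1 := by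
        intro s hs
        rw [zero_mul, zero_mul, add_zero, add_zero]
        refine abs_le_mul_pow_succ_of_hasDerivAt (k := 0) (e := fun s => r (a + t + s) - r (a + t))
          (e' := fun s => iteratedDeriv 1 r (a + (t + s))) hC0 (by simp)
          (fun u hu => ?_) (fun u hu => ?_) hs
        · have := h.hasDerivAt 0 η (t + u) (hlt u hu)
          rw [iteratedDeriv_zero, ← add_assoc] at this
          rw [← add_assoc]
          exact (this.comp_const_add _ _).sub_const _
        · simpa using hC η (t + u) (hlt u hu)
      have hev : ∀ᶠ n : ℕ in atTop, 1 / ((n : ℝ) + 1) < δ - |t| := hlim.eventually_lt_const hδ'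
      rw [tendsto_iff_norm_sub_tendsto_zero]
      refine squeeze_zero' (Eventually.of_forall fun n => norm_nonneg _)
        (g := fun n : ℕ => C * (1 / ((n : ℝ) + 1))) ?_ (by simpa using hlim.const_mul C)
      filter_upwards [hev] with n hn
      have hb := abs_integral_slab_sub_le (hpos n) hn hC0 (fun s hs => by
        have := h.continuousAt η (hlt s hs)
        rwa [← add_assoc] at this) htay
      rw [slabIntegral_eq hg (hpos n).le (norm_coe_S2 η)]
      set ε := 1 / ((n : ℝ) + 1)
      set I := ∫ q in (a + t - ε)..(a + t + ε), r q
      have hε : 0 < ε := hpos n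
      clear_value I ε
      have : ε⁻¹ * (1 / 2 * I) - r (a + t) =
          (I - (2 * ε * r (a + t) + 2 / 3 * 0 * ε ^ 3)) / (2 * ε) := by
        field_simp
        ring
      rw [this, Real.norm_eq_abs, abs_div, abs_of_pos (by positivity : 0 < 2 * ε),
        div_le_iff₀ (by positivity)]
      refine hb.trans (le_of_eq ?_)
      ring
  | succ k ih =>
    -- Starting the sequence at `N` keeps `t + 1/(n + N + 1)` within the radius `δ` for every `n`,
    -- so that the induction hypothesis applies to each term.
    obtain ⟨N, hN⟩ := (hlim.eventually_lt_const (sub_pos.2 ht)).exists_forall_of_atTop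
    refine measurable_of_tendsto_metrizable (f := fun (n : ℕ) (η : S2) =>
      (1 / (((n + N : ℕ) : ℝ) + 1))⁻¹ * (iteratedDeriv k (radonScalar g η)
        (inner ℝ (η : E3) x + (t + 1 / (((n + N : ℕ) : ℝ) + 1))) -
          iteratedDeriv k (radonScalar g η) (inner ℝ (η : E3) x + t)))
      (fun n => ?_) ?_
    · refine ((ih ?_).sub (ih ht)).const_mul _
      have h1 := hN (n + N) (Nat.le_add_left _ _)
      have h2 := abs_add_le t (1 / (((n + N : ℕ) : ℝ) + 1))
      rw [abs_of_pos (hpos (n + N))] at h2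
      linarith
    · rw [tendsto_pi_nhds]
      intro η
      have h1 := (h.hasDerivAt_shift k η ht).tendsto_slope_zero_right
      have h2 : Tendsto (fun n : ℕ => 1 / (((n + N : ℕ) : ℝ) + 1)) atTop (𝓝[>] 0) :=
        tendsto_nhdsWithin_iff.2 ⟨hlim.comp (tendsto_add_atTop_nat N),
          Eventually.of_forall fun n => hpos (n + N)⟩
      exact h1.comp h2

end IsRadonRegularAt

/-! ### Averaging slabs over directions and the Radon inversion formula -/

theorem integral_slabIntegral {g : E3 → ℝ} (hg : Integrable g) (x : E3) {ε : ℝ}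
    (hε : 0 < ε) :
    ∫ η : S2, slabIntegral g ε η (inner ℝ (η : E3) x) ∂surfaceMeasure =
      ∫ y, 4 * Real.pi * min 1 (ε / ‖y - x‖) * g y := by
  have hind : ∀ (η y : E3), (Set.Ioo (inner ℝ η x - ε) (inner ℝ η x + ε)).indicator
      (fun _ => (1 : ℝ)) (inner ℝ η y) =
        (Set.Ioo (-ε) ε).indicator (fun _ => (1 : ℝ)) (inner ℝ η (y - x)) := by
    intro η y
    rw [inner_sub_right]
    simp only [Set.indicator_apply, Set.mem_Ioo]
    congr 1
    apply propext
    constructor <;> rintro ⟨h1, h2⟩ <;> constructor <;> linarith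
  unfold slabIntegral
  simp_rw [hind]
  rw [integral_integral_swap]
  -- After Fubini the inner integral is the area of the zone `|η·(y - x)| < ε`. The area formula
  -- fails at `y = x`, where `ε / 0 = 0`, but a single point is negligible.
  · have hne : ∀ᵐ y : E3, y ≠ x := by
      rw [ae_iff]
      simp
    refine integral_congr_ae ?_
    filter_upwards [hne] with y hy
    rw [integral_mul_const]
    congr 1
    rw [← surfaceMeasure_real_zone (sub_ne_zero.2 hy) hε]
    have hm : MeasurableSet {η : S2 | |inner ℝ (η : E3) (y - x)| < ε} :=
      measurableSet_lt (by fun_prop) measurable_const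
    rw [← integral_indicator_one hm]
    congr 1
    ext η
    simp only [Set.indicator_apply, Set.mem_Ioo, Set.mem_ofPred_eq, abs_lt, Pi.one_apply]
  · have h1 : Integrable (fun q : S2 × E3 => (1 : ℝ) * g q.2) (surfaceMeasure.prod volume) :=
      Integrable.mul_prod (integrable_const (1 : ℝ)) hg
    simp only [one_mul] at h1
    refine h1.bdd_mul (c := 1) ?_ (Eventually.of_forall fun q => ?_)
    · exact ((measurable_const.indicator measurableSet_Ioo).comp
        (by fun_prop : Continuous fun q : S2 × E3 =>
          inner ℝ (q.1 : E3) (q.2 - x)).measurable).aestronglyMeasurable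
    · refine (norm_indicator_le_norm_self _ _).trans ?_
      simp

/-- The radial kernel that results from averaging a second difference of slabs over all
directions. -/
noncomputable def averagedKernel (ρ : ℝ) : ℝ :=
  4 * Real.pi * (1 / 2 * min 1 (2 / ρ) - min 1 (1 / ρ))

/-- The weights `1/2` and `1` are those for which the tails `2/ρ` and `1/ρ` cancel, giving compact
support. The same weights cancel the zeroth order term of the slab expansion. -/
theorem averagedKernel_eq_zero {ρ : ℝ} (h : 2 ≤ ρ) : averagedKernel ρ = 0 := by
  have h1 : 2 / ρ ≤ 1 := (div_le_one (by linarith)).2 h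
  have h2 : 1 / ρ ≤ 1 := (div_le_one (by linarith)).2 (by linarith)
  rw [averagedKernel, min_eq_right h1, min_eq_right h2]
  ring

theorem abs_averagedKernel_le {ρ : ℝ} (hρ : 0 ≤ ρ) : |averagedKernel ρ| ≤ 4 * Real.pi := by
  have hpi := Real.pi_pos
  rw [averagedKernel, abs_mul, abs_of_pos (by positivity)]
  refine mul_le_of_le_one_right (by positivity) ?_
  have h1 : 0 ≤ min 1 (2 / ρ) := le_min zero_le_one (by positivity)
  have h2 : 0 ≤ min 1 (1 / ρ) := le_min zero_le_one (by positivity)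
  have h3 : min 1 (2 / ρ) ≤ 1 := min_le_left _ _
  have h4 : min 1 (1 / ρ) ≤ 1 := min_le_left _ _
  rw [abs_le]
  constructor <;> linarith

theorem measurable_averagedKernel : Measurable averagedKernel := by
  unfold averagedKernel
  fun_prop

/-- The kernel is `-2π` on `(0, 1)` and `2π - 4π/ρ` on `(1, 2)`. In spherical coordinates the
integral is `4π (-2π/3 + 14π/3 - 6π)`. -/
theorem integral_averagedKernel : ∫ v : E3, averagedKernel ‖v‖ = -(8 * Real.pi ^ 2) := by
  have hpi := Real.pi_pos
  rw [integral_fun_norm_addHaar, measureReal_def, EuclideanSpace.volume_ball_fin_three,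
    ENNReal.ofReal_one, one_pow, one_mul, ENNReal.toReal_ofReal (by positivity)]
  have h0 : ∫ ρ in Set.Ioi (0 : ℝ), ρ ^ (Module.finrank ℝ E3 - 1) • averagedKernel ρ =
      ∫ ρ in Set.Ioc (0 : ℝ) 2, ρ ^ 2 * averagedKernel ρ := by
    simp only [finrank_euclideanSpace, Fintype.card_fin, smul_eq_mul]
    refine setIntegral_eq_of_subset_of_forall_sdiff_eq_zero measurableSet_Ioi
      (fun r hr => hr.1) fun r hr => ?_
    have : 2 ≤ r := by
      by_contra h
      exact hr.2 ⟨hr.1, (not_le.1 h).le⟩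
    rw [averagedKernel_eq_zero this, mul_zero]
  have hm : ∀ a b : ℝ, 0 ≤ a → a ≤ b →
      IntervalIntegrable (fun ρ => ρ ^ 2 * averagedKernel ρ) volume a b := by
    intro a b ha hab
    rw [intervalIntegrable_iff_integrableOn_Ioc_of_le hab]
    refine Measure.integrableOn_of_bounded (M := b ^ 2 * (4 * Real.pi)) (by simp)
      ((measurable_id.pow_const 2).mul measurable_averagedKernel).aestronglyMeasurable
      (ae_restrict_of_forall_mem measurableSet_Ioc fun ρ hρ => ?_)
    have hρ0 : 0 ≤ ρ := ha.trans hρ.1.le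
    rw [norm_mul, Real.norm_of_nonneg (by simpa using sq_nonneg ρ)]
    exact mul_le_mul (pow_le_pow_left₀ hρ0 hρ.2 2) (abs_averagedKernel_le hρ0) (abs_nonneg _)
      (by positivity)
  rw [h0, ← intervalIntegral.integral_of_le (by norm_num),
    ← intervalIntegral.integral_add_adjacent_intervals (hm 0 1 le_rfl zero_le_one)
      (hm 1 2 zero_le_one one_le_two)]
  have h1 : ∫ ρ in (0 : ℝ)..1, ρ ^ 2 * averagedKernel ρ = ∫ ρ in (0 : ℝ)..1, -(2 * Real.pi) * ρ ^ 2 := by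
    refine intervalIntegral.integral_congr_ae (Eventually.of_forall fun ρ hρ => ?_)
    rw [Set.uIoc_of_le zero_le_one] at hρ
    have h2 : 1 ≤ 2 / ρ := (one_le_div hρ.1).2 (by linarith [hρ.2])
    have h3 : 1 ≤ 1 / ρ := (one_le_div hρ.1).2 hρ.2
    rw [averagedKernel, min_eq_left h2, min_eq_left h3]
    ring
  have h2 : ∫ ρ in (1 : ℝ)..2, ρ ^ 2 * averagedKernel ρ =
      ∫ ρ in (1 : ℝ)..2, (2 * Real.pi * ρ ^ 2 - 4 * Real.pi * ρ) := by
    refine intervalIntegral.integral_congr fun ρ hρ => ?_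
    rw [Set.uIcc_of_le one_le_two] at hρ
    have hρ0 : 0 < ρ := by linarith [hρ.1]
    have h2 : 1 ≤ 2 / ρ := (one_le_div hρ0).2 hρ.2
    have h3 : 1 / ρ ≤ 1 := (div_le_one hρ0).2 hρ.1
    simp only [averagedKernel, min_eq_left h2, min_eq_right h3]
    field_simp
    ring
  rw [h1, h2, intervalIntegral.integral_sub (Continuous.intervalIntegrable (by fun_prop) _ _)
    (Continuous.intervalIntegrable (by fun_prop) _ _), intervalIntegral.integral_const_mul,
    intervalIntegral.integral_const_mul, intervalIntegral.integral_const_mul, integral_pow,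
    integral_pow, integral_id]
  simp only [finrank_euclideanSpace, Fintype.card_fin, smul_eq_mul, nsmul_eq_mul]
  norm_num
  ring

/-- The integral of `g` against the averaged second difference of slabs of width `ε`. -/
theorem integral_slab_second_difference {g : E3 → ℝ} (hg : Integrable g) (x : E3) {ε : ℝ}
    (hε : 0 < ε) :
    (∫ y, 4 * Real.pi * min 1 (2 * ε / ‖y - x‖) * g y) / 2 -
        ∫ y, 4 * Real.pi * min 1 (ε / ‖y - x‖) * g y =
      ε ^ 3 * ∫ v, averagedKernel ‖v‖ * g (x + ε • v) := by
  have hpi := Real.pi_pos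
  have hint : ∀ c : ℝ, 0 ≤ c → Integrable fun y => 4 * Real.pi * min 1 (c / ‖y - x‖) * g y := by
    intro c hc
    refine hg.bdd_mul (c := 4 * Real.pi)
      (Measurable.aestronglyMeasurable (by fun_prop)) (Eventually.of_forall fun y => ?_)
    have h1 : 0 ≤ min 1 (c / ‖y - x‖) := le_min zero_le_one (by positivity)
    rw [Real.norm_of_nonneg (by positivity)]
    exact mul_le_of_le_one_right (by positivity) (min_le_left _ _)
  rw [← integral_div, ← integral_sub ((hint _ (by positivity)).div_const 2) (hint _ hε.le)]
  have h1 : ∀ y, 4 * Real.pi * min 1 (2 * ε / ‖y - x‖) * g y / 2 -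
      4 * Real.pi * min 1 (ε / ‖y - x‖) * g y =
        (fun w => averagedKernel ‖ε⁻¹ • w‖ * g (x + ε • ε⁻¹ • w)) (y - x) := by
    intro y
    have e1 : 2 / ‖ε⁻¹ • (y - x)‖ = 2 * ε / ‖y - x‖ := by
      rw [norm_smul, norm_inv, Real.norm_of_nonneg hε.le]
      field_simp
    have e2 : 1 / ‖ε⁻¹ • (y - x)‖ = ε / ‖y - x‖ := by
      rw [norm_smul, norm_inv, Real.norm_of_nonneg hε.le]
      field_simp
    simp only [averagedKernel, e1, e2, smul_smul, mul_inv_cancel₀ hε.ne', one_smul,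
      add_sub_cancel]
    ring
  simp_rw [h1]
  rw [integral_sub_right_eq_self (fun w => averagedKernel ‖ε⁻¹ • w‖ * g (x + ε • ε⁻¹ • w)) x,
    Measure.integral_comp_inv_smul volume (fun v => averagedKernel ‖v‖ * g (x + ε • v))]
  simp [abs_of_pos hε]

/-- An approximate identity argument: the kernel is bounded and supported in the ball of radius `2`,
so continuity of `g` at the single point `x` and boundedness elsewhere suffice. -/
theorem tendsto_integral_averagedKernel {g : E3 → ℝ} (hg : Measurable g) {M : ℝ}
    (hM : ∀ y, |g y| ≤ M) {x : E3} (hx : ContinuousAt g x) :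
    Tendsto (fun ε : ℝ => ∫ v, averagedKernel ‖v‖ * g (x + ε • v)) (𝓝[>] 0)
      (𝓝 (-(8 * Real.pi ^ 2) * g x)) := by
  rw [← integral_averagedKernel, ← integral_mul_const]
  refine tendsto_integral_filter_of_dominated_convergence
    (fun v => (Metric.closedBall (0 : E3) 2).indicator (fun _ => 4 * Real.pi * M) v) ?_ ?_ ?_ ?_
  · refine Eventually.of_forall fun ε => ?_
    exact ((measurable_averagedKernel.comp measurable_norm).mul
      (hg.comp (by fun_prop))).aestronglyMeasurable
  · refine Eventually.of_forall fun ε => Eventually.of_forall fun v => ?_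
    by_cases hv : v ∈ Metric.closedBall (0 : E3) 2
    · rw [Set.indicator_of_mem hv, norm_mul]
      exact mul_le_mul (abs_averagedKernel_le (norm_nonneg v)) (hM _) (norm_nonneg _)
        (by positivity)
    · rw [mem_closedBall_zero_iff, not_le] at hv
      rw [averagedKernel_eq_zero hv.le, Set.indicator_of_notMem (by simpa using hv)]
      simp
  · exact (integrable_indicator_iff Metric.isClosed_closedBall.measurableSet).2
      (integrableOn_const (isCompact_closedBall _ _).measure_lt_top.ne)
  · refine Eventually.of_forall fun v => ?_
    have h1 : Tendsto (fun ε : ℝ => x + ε • v) (𝓝[>] 0) (𝓝 x) := by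
      have : Continuous fun ε : ℝ => x + ε • v := by fun_prop
      have := this.tendsto 0
      simp only [zero_smul, add_zero] at this
      exact this.mono_left nhdsWithin_le_nhds
    exact (hx.tendsto.comp h1).const_mul _

theorem IsRadonRegularAt.integrable_mul {g : E3 → ℝ} {x : E3} {δ : ℝ}
    (h : IsRadonRegularAt g x δ) (hg : Integrable g) (hgm : Measurable g) (k : ℕ) {t : ℝ}
    (ht : |t| < δ) {c : S2 → ℝ} (hc : Continuous c) :
    Integrable (fun η : S2 => c η * iteratedDeriv k (radonScalar g η) (inner ℝ (η : E3) x + t))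
      surfaceMeasure := by
  obtain ⟨C, -, hC⟩ := h.bound k
  obtain ⟨B, hB⟩ := isCompact_univ.exists_bound_of_continuousOn hc.continuousOn
  refine Integrable.bdd_mul (c := B) ?_ hc.aestronglyMeasurable
    (Eventually.of_forall fun η => hB η trivial)
  exact Integrable.of_bound (h.measurable_iteratedDeriv hg hgm k ht).aestronglyMeasurable C
    (Eventually.of_forall fun η => hC η t ht)

/-- The Radon inversion formula at a point of continuity where the Radon transform is regular. -/
theorem IsRadonRegularAt.integral_second_deriv {g : E3 → ℝ} {x : E3} {δ : ℝ}
    (h : IsRadonRegularAt g x δ) (hg : Integrable g) (hgm : Measurable g) {M : ℝ}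
    (hM : ∀ y, |g y| ≤ M) (hx : ContinuousAt g x) :
    ∫ η : S2, iteratedDeriv 2 (radonScalar g η) (inner ℝ (η : E3) x) ∂surfaceMeasure =
      -(8 * Real.pi ^ 2) * g x := by
  -- The kernel integrals have two limits to compare: a multiple of `g x` by the approximate
  -- identity, and the integrated second derivative by the slab expansion.
  refine tendsto_nhds_unique ?_ (tendsto_integral_averagedKernel hgm hM hx)
  obtain ⟨C, hC0, hC⟩ := h.abs_taylor_two
  have hint2 : Integrable (fun η : S2 => iteratedDeriv 2 (radonScalar g η) (inner ℝ (η : E3) x))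
      surfaceMeasure := by
    simpa using h.integrable_mul hg hgm 2 (t := 0) (by simpa using h.pos) (c := fun _ => 1)
      continuous_const
  have hslabint : ∀ ε, 0 < ε → ε < δ → Integrable (fun η : S2 =>
      slabIntegral g ε η (inner ℝ (η : E3) x)) surfaceMeasure := by
    intro ε hε hεδ
    refine Integrable.of_bound (measurable_slabIntegral hgm ε (by fun_prop)).aestronglyMeasurable
      (∫ y, |g y|) (Eventually.of_forall fun η => ?_)
    refine (norm_integral_le_integral_norm _).trans (integral_mono
      (integrable_indicator_mul hg measurableSet_Ioo _).norm hg.norm fun y => ?_)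
    simp only [norm_mul]
    refine mul_le_of_le_one_left (norm_nonneg _) ((norm_indicator_le_norm_self _ _).trans ?_)
    simp
  have hslab : ∀ ε, 0 < ε → ε < δ → ∀ η : S2, |slabIntegral g ε η (inner ℝ (η : E3) x) -
      (2 * ε * radonScalar g η (inner ℝ (η : E3) x) +
        2 / 3 * (iteratedDeriv 2 (radonScalar g η) (inner ℝ (η : E3) x) / 2) * ε ^ 3)| ≤
          2 * C * ε ^ 4 := by
    intro ε hε hεδ η
    rw [slabIntegral_eq hg hε.le (norm_coe_S2 η)]
    exact abs_integral_slab_sub_le hε hεδ hC0 (fun s hs => h.continuousAt η hs) (hC η)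
  rw [tendsto_iff_norm_sub_tendsto_zero]
  -- The slab errors are `2Cε⁴` and half of `2C(2ε)⁴`, together `18Cε⁴`. Division by `ε³` and
  -- integration over a sphere of area `4π` give this bound.
  have hlim : Tendsto (fun ε : ℝ => 18 * C * ε * (4 * Real.pi)) (𝓝[>] 0) (𝓝 0) := by
    have : Continuous fun ε : ℝ => 18 * C * ε * (4 * Real.pi) := by fun_prop
    have := this.tendsto 0
    simp only [mul_zero, zero_mul] at this
    exact this.mono_left nhdsWithin_le_nhds
  refine squeeze_zero' (Eventually.of_forall fun ε => norm_nonneg _) ?_ hlim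
  filter_upwards [Ioo_mem_nhdsGT (half_pos h.pos)] with ε hε
  have hε0 : 0 < ε := hε.1
  have h2ε : 2 * ε < δ := by linarith [hε.2]
  have hkey := integral_slab_second_difference hg x hε0
  rw [← integral_slabIntegral hg x hε0, ← integral_slabIntegral hg x (by positivity : 0 < 2 * ε),
    ← integral_div, ← integral_sub ((hslabint _ (by positivity) h2ε).div_const 2)
      (hslabint _ hε0 (by linarith))] at hkey
  have hcube : 0 < ε ^ 3 := by positivity
  have heq : ∫ v, averagedKernel ‖v‖ * g (x + ε • v) = ∫ η : S2, (ε ^ 3)⁻¹ *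
      (slabIntegral g (2 * ε) η (inner ℝ (η : E3) x) / 2 -
        slabIntegral g ε η (inner ℝ (η : E3) x)) ∂surfaceMeasure := by
    rw [integral_const_mul, hkey, inv_mul_cancel_left₀ hcube.ne']
  have hdiff : Integrable (fun η : S2 => (ε ^ 3)⁻¹ *
      (slabIntegral g (2 * ε) η (inner ℝ (η : E3) x) / 2 -
        slabIntegral g ε η (inner ℝ (η : E3) x))) surfaceMeasure :=
    (((hslabint _ (by positivity) h2ε).div_const 2).sub (hslabint _ hε0 (by linarith))).const_mul _
  rw [heq, norm_sub_rev, ← integral_sub hint2 hdiff, ← surfaceMeasure_real_univ]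
  refine norm_integral_le_of_norm_le_const (Eventually.of_forall fun η => ?_)
  have e1 := hslab ε hε0 (by linarith) η
  have e2 := hslab (2 * ε) (by positivity) h2ε η
  generalize slabIntegral g ε η (inner ℝ (η : E3) x) = A at e1 ⊢
  generalize slabIntegral g (2 * ε) η (inner ℝ (η : E3) x) = B at e2 ⊢
  generalize radonScalar g η (inner ℝ (η : E3) x) = r0 at e1 e2 ⊢
  generalize iteratedDeriv 2 (radonScalar g η) (inner ℝ (η : E3) x) = r2 at e1 e2 ⊢
  have e3 : r2 - (ε ^ 3)⁻¹ * (B / 2 - A) = (ε ^ 3)⁻¹ *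
      ((A - (2 * ε * r0 + 2 / 3 * (r2 / 2) * ε ^ 3)) -
        (B - (2 * (2 * ε) * r0 + 2 / 3 * (r2 / 2) * (2 * ε) ^ 3)) / 2) := by
    field_simp
    ring
  rw [e3, norm_mul, norm_inv, Real.norm_of_nonneg hcube.le, inv_mul_le_iff₀ hcube]
  have e4 := abs_le.1 e1
  have e5 := abs_le.1 e2
  rw [Real.norm_eq_abs, abs_le]
  constructor <;> nlinarith

/-! ### Weighted backprojections and their derivatives -/

/-- Weighted backprojection of the `k`-th derivative of the Radon transform. -/
noncomputable def backprojection (g : E3 → ℝ) (c : S2 → ℝ) (k : ℕ) (x : E3) : ℝ :=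
  ∫ η : S2, c η * iteratedDeriv k (radonScalar g η) (inner ℝ (η : E3) x) ∂surfaceMeasure

theorem continuous_coord_S2 (i : Fin 3) : Continuous fun η : S2 => (η : E3) i := by fun_prop

namespace IsSmoothCutoff

variable {D : Set E3} {F g : E3 → ℝ}

theorem integrable_backprojection (hg : IsSmoothCutoff D F g) (hD : IsSmoothConvexDomain D)
    {c : S2 → ℝ} (hc : Continuous c) (k : ℕ) {x : E3} (hx : x ∈ D) :
    Integrable (fun η : S2 => c η * iteratedDeriv k (radonScalar g η) (inner ℝ (η : E3) x))
      surfaceMeasure := by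
  obtain ⟨δ, -, h⟩ := exists_isRadonRegularAt hD hg hx
  simpa using h.integrable_mul (hg.integrable hD.isBounded) hg.measurable k (t := 0)
    (by simpa using h.pos) hc

/-- Since `x` enters only through `η·x`, each partial derivative raises the order by one and
multiplies the weight by `η_i`. The bounds uniform in `η` supply the domination. The class of
backprojections is thus closed under differentiation. -/
theorem hasFDerivAt_backprojection (hg : IsSmoothCutoff D F g) (hD : IsSmoothConvexDomain D)
    {c : S2 → ℝ} (hc : Continuous c) (k : ℕ) {x : E3} (hx : x ∈ D) :
    HasFDerivAt (backprojection g c k)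
      (∑ i, backprojection g (fun η => c η * (η : E3) i) (k + 1) x •
        (EuclideanSpace.proj i : E3 →L[ℝ] ℝ)) x := by
  obtain ⟨δ, hball, h⟩ := exists_isRadonRegularAt hD hg hx
  obtain ⟨C, hC0, hC⟩ := h.bound (k + 1)
  obtain ⟨B, hB⟩ := isCompact_univ.exists_bound_of_continuousOn hc.continuousOn
  have hshift : ∀ z ∈ Metric.ball x δ, ∀ η : S2,
      ∃ t, |t| < δ ∧ inner ℝ (η : E3) z = inner ℝ (η : E3) x + t := by
    intro z hz η
    refine ⟨inner ℝ (η : E3) (z - x), ?_, by rw [inner_sub_right]; ring⟩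
    refine (abs_real_inner_le_norm _ _).trans_lt ?_
    rwa [norm_coe_S2, one_mul, ← dist_eq_norm]
  set F' : E3 → S2 → E3 →L[ℝ] ℝ := fun z η =>
    (c η * iteratedDeriv (k + 1) (radonScalar g η) (inner ℝ (η : E3) z)) • innerSL ℝ (η : E3)
    with hF'
  have hF'meas : AEStronglyMeasurable (F' x) surfaceMeasure := by
    refine (hg.integrable_backprojection hD hc (k + 1) hx).aestronglyMeasurable.smul ?_
    exact ((innerSL ℝ).continuous.comp continuous_subtype_val).aestronglyMeasurable
  have hF'bound : ∀ η : S2, ∀ z ∈ Metric.ball x δ, ‖F' z η‖ ≤ B * C := by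
    intro η z hz
    obtain ⟨t, ht, hzt⟩ := hshift z hz η
    rw [hF', norm_smul, innerSL_apply_norm, norm_coe_S2, mul_one, hzt, norm_mul]
    exact mul_le_mul (hB η trivial) (hC η t ht) (norm_nonneg _)
      ((norm_nonneg _).trans (hB η trivial))
  have hF'int : Integrable (F' x) surfaceMeasure :=
    Integrable.of_bound hF'meas (B * C)
      (Eventually.of_forall fun η => hF'bound η x (Metric.mem_ball_self h.pos))
  have key : HasFDerivAt (backprojection g c k) (∫ η, F' x η ∂surfaceMeasure) x := by
    refine hasFDerivAt_integral_of_dominated_of_fderiv_le (F' := F') (bound := fun _ => B * C)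
      (Metric.ball_mem_nhds x h.pos) ?_ (hg.integrable_backprojection hD hc k hx) hF'meas
      (Eventually.of_forall hF'bound) (integrable_const _) ?_
    · filter_upwards [Metric.ball_mem_nhds x h.pos] with z hz
      exact (hg.integrable_backprojection hD hc k (hball hz)).aestronglyMeasurable
    · refine Eventually.of_forall fun η z hz => ?_
      obtain ⟨t, ht, hzt⟩ := hshift z hz η
      have h1 := h.hasDerivAt k η t ht
      rw [← hzt] at h1
      have h2 := (h1.comp_hasFDerivAt z (innerSL ℝ (η : E3)).hasFDerivAt).const_mul (c η)
      rw [smul_smul] at h2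
      exact h2
  refine key.congr_fderiv ?_
  ext v
  rw [ContinuousLinearMap.integral_apply hF'int]
  simp only [sum_apply, smul_apply, smul_eq_mul,
    PiLp.proj_apply]
  simp only [backprojection]
  simp_rw [← integral_mul_const]
  rw [← integral_finsetSum]
  · congr 1
    ext η
    simp only [hF', smul_apply, innerSL_apply_apply, smul_eq_mul,
      PiLp.inner_apply, RCLike.inner_apply, conj_trivial, Finset.mul_sum]
    refine Finset.sum_congr rfl fun i _ => ?_
    ring
  · intro i _
    exact (hg.integrable_backprojection hD (hc.mul (continuous_coord_S2 i)) (k + 1) hx).mul_const _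

theorem contDiffOn_backprojection (hg : IsSmoothCutoff D F g) (hD : IsSmoothConvexDomain D)
    (n : ℕ) {c : S2 → ℝ} (hc : Continuous c) (k : ℕ) :
    ContDiffOn ℝ n (backprojection g c k) D := by
  induction n generalizing c k with
  | zero =>
    rw [Nat.cast_zero, contDiffOn_zero]
    exact fun x hx => (hg.hasFDerivAt_backprojection hD hc k hx).continuousAt.continuousWithinAt
  | succ n ih =>
    rw [Nat.cast_succ, contDiffOn_succ_iff_fderiv_of_isOpen hD.isOpen]
    refine ⟨fun x hx => (hg.hasFDerivAt_backprojection hD hc k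
      hx).differentiableAt.differentiableWithinAt, by simp, ?_⟩
    have : ContDiffOn ℝ n (fun x => ∑ i, backprojection g (fun η => c η * (η : E3) i) (k + 1) x •
        (EuclideanSpace.proj i : E3 →L[ℝ] ℝ)) D :=
      ContDiffOn.sum fun i _ => (ih (hc.mul (continuous_coord_S2 i)) (k + 1)).smul contDiffOn_const
    exact this.congr fun x hx => (hg.hasFDerivAt_backprojection hD hc k hx).fderiv

/-- Radon's inversion formula inside the domain. -/
theorem backprojection_one_two (hg : IsSmoothCutoff D F g) (hD : IsSmoothConvexDomain D)
    {x : E3} (hx : x ∈ D) :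
    backprojection g (fun _ => 1) 2 x = -(8 * Real.pi ^ 2) * g x := by
  obtain ⟨δ, -, h⟩ := exists_isRadonRegularAt hD hg hx
  obtain ⟨M, -, hM⟩ := hg.exists_bound hD.isBounded
  simp only [backprojection, one_mul]
  exact h.integral_second_deriv (hg.integrable hD.isBounded) hg.measurable hM
    (hg.continuousAt hD.isOpen hx)

end IsSmoothCutoff

/-! ### Gradient, curl and divergence -/

section VectorCalculus

theorem gradient_apply_coord (u : E3 → ℝ) (x : E3) (i : Fin 3) :
    gradient u x i = fderiv ℝ u x (EuclideanSpace.single i 1) := by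
  rw [gradient, ← InnerProductSpace.toDual_symm_apply (𝕜 := ℝ) (x := EuclideanSpace.single i 1)
    (y := fderiv ℝ u x), EuclideanSpace.inner_single_right]
  simp

theorem partialDeriv_eq_fderiv_coord {F : E3 → E3} {x : E3} (hF : DifferentiableAt ℝ F x)
    (i j : Fin 3) :
    partialDeriv i j F x = fderiv ℝ (fun y => F y j) x (EuclideanSpace.single i 1) := by
  have h := (EuclideanSpace.proj j : E3 →L[ℝ] ℝ).hasFDerivAt.comp x hF.hasFDerivAt
  have h2 : HasFDerivAt (fun y => F y j) _ x := h
  rw [h2.fderiv]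
  rfl

variable {u : E3 → ℝ} {x : E3}

theorem differentiableAt_gradient (hu : ContDiffAt ℝ 2 u x) :
    DifferentiableAt ℝ (gradient u) x := by
  have h : DifferentiableAt ℝ (fderiv ℝ u) x :=
    (hu.fderiv_right (m := 1) (by norm_num)).differentiableAt (by norm_num)
  exact (InnerProductSpace.toDual ℝ E3).symm.toContinuousLinearEquiv.differentiableAt.comp x h

theorem partialDeriv_gradient (hu : ContDiffAt ℝ 2 u x) (i j : Fin 3) :
    partialDeriv i j (gradient u) x = fderiv ℝ (fderiv ℝ u) x (EuclideanSpace.single i 1)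
      (EuclideanSpace.single j 1) := by
  have h : DifferentiableAt ℝ (fderiv ℝ u) x :=
    (hu.fderiv_right (m := 1) (by norm_num)).differentiableAt (by norm_num)
  rw [partialDeriv_eq_fderiv_coord (differentiableAt_gradient hu)]
  simp_rw [gradient_apply_coord]
  rw [fderiv_clm_apply h (differentiableAt_const _)]
  simp

theorem curl_gradient (hu : ContDiffAt ℝ 2 u x) : curl (gradient u) x = 0 := by
  have hs : ∀ i j, partialDeriv i j (gradient u) x = partialDeriv j i (gradient u) x := by
    intro i j
    rw [partialDeriv_gradient hu, partialDeriv_gradient hu]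
    exact (hu.isSymmSndFDerivAt (by simp)).eq _ _
  rw [curl, hs 1 2, hs 2 0, hs 0 1]
  ext i
  fin_cases i <;> simp

theorem divergence_gradient (hu : ContDiffAt ℝ 2 u x) :
    divergence (gradient u) x = Laplacian.laplacian u x := by
  rw [InnerProductSpace.laplacian_eq_iteratedFDeriv_orthonormalBasis u
    (EuclideanSpace.basisFun (Fin 3) ℝ), divergence]
  refine Finset.sum_congr rfl fun i _ => ?_
  rw [partialDeriv_gradient hu, iteratedFDeriv_two_apply]
  simp

theorem partialDeriv_congr {F G : E3 → E3} (h : F =ᶠ[𝓝 x] G) (i j : Fin 3) :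
    partialDeriv i j F x = partialDeriv i j G x := by
  rw [partialDeriv, partialDeriv, h.fderiv_eq]

theorem divergence_congr {F G : E3 → E3} (h : F =ᶠ[𝓝 x] G) : divergence F x = divergence G x :=
  Finset.sum_congr rfl fun i _ => partialDeriv_congr h i i

theorem curl_congr {F G : E3 → E3} (h : F =ᶠ[𝓝 x] G) : curl F x = curl G x := by
  simp only [curl, partialDeriv_congr h]

theorem partialDeriv_add {F G : E3 → E3} (hF : DifferentiableAt ℝ F x)
    (hG : DifferentiableAt ℝ G x) (i j : Fin 3) :
    partialDeriv i j (fun y => F y + G y) x = partialDeriv i j F x + partialDeriv i j G x := by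
  simp only [partialDeriv, fderiv_fun_add hF hG]
  simp

theorem divergence_add {F G : E3 → E3} (hF : DifferentiableAt ℝ F x)
    (hG : DifferentiableAt ℝ G x) :
    divergence (fun y => F y + G y) x = divergence F x + divergence G x := by
  simp only [divergence, partialDeriv_add hF hG, Finset.sum_add_distrib]

theorem curl_add {F G : E3 → E3} (hF : DifferentiableAt ℝ F x) (hG : DifferentiableAt ℝ G x) :
    curl (fun y => F y + G y) x = curl F x + curl G x := by
  simp only [curl, partialDeriv_add hF hG]
  ext i
  fin_cases i <;> simp <;> ring

end VectorCalculus

/-! ### The first part as the field plus a gradient -/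

section VectorRadon

theorem continuous_coord_mul_S2 (i j : Fin 3) :
    Continuous fun η : S2 => (η : E3) i * (η : E3) j := by fun_prop

theorem continuous_coord_mul_mul_S2 (i j k : Fin 3) :
    Continuous fun η : S2 => (η : E3) i * (η : E3) j * (η : E3) k := by fun_prop

variable {D : Set E3} {f : E3 → E3}

theorem IsSmoothFieldSupportedIn.exists_isSmoothCutoff (hf : IsSmoothFieldSupportedIn D f) :
    ∃ F : E3 → E3, ContDiff ℝ ∞ F ∧ Set.EqOn f F (closure D) ∧
      ∀ i, IsSmoothCutoff D (fun x => F x i) (fun x => f x i) := by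
  obtain ⟨⟨F, hF, hfF⟩, h0⟩ := hf
  refine ⟨F, hF, hfF, fun i => ⟨contDiff_euclidean.1 hF i, fun x hx => ?_, fun x hx => ?_⟩⟩
  · simp only [hfF hx]
  · simp only [h0 x hx]; rfl

/-- Coordinates commute with the integral once the restriction of `f` to the plane is known to be
integrable; the plane meets the closure of `D` in a compact set, on which `f` is continuous. -/
theorem radon_apply (hD : IsSmoothConvexDomain D) (hf : IsSmoothFieldSupportedIn D f) (p : ℝ)
    (η : E3) (i : Fin 3) : radon f p η i = radonScalar (fun x => f x i) η p := by
  obtain ⟨F, hF, hfF, hcut⟩ := hf.exists_isSmoothCutoff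
  have hfi : f = (closure D).indicator F := by
    ext1 x
    by_cases hx : x ∈ closure D
    · rw [Set.indicator_of_mem hx, hfF hx]
    · rw [Set.indicator_of_notMem hx, hf.2 x hx]
  have hcont : Continuous fun y : (Submodule.span ℝ {η})ᗮ => p • η + (y : E3) := by fun_prop
  have hint : Integrable fun y : (Submodule.span ℝ {η})ᗮ => f (p • η + (y : E3)) := by
    have hS : IsCompact ((fun y : (Submodule.span ℝ {η})ᗮ => p • η + (y : E3)) ⁻¹' closure D) := by
      have hemb : Topology.IsClosedEmbedding fun y : (Submodule.span ℝ {η})ᗮ => p • η + (y : E3) :=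
        (Homeomorph.addLeft (p • η)).isClosedEmbedding.comp
          (Submodule.closed_of_finiteDimensional _).isClosedEmbedding_subtypeVal
      exact hemb.isCompact_preimage hD.isBounded.isCompact_closure
    have h1 : (fun y : (Submodule.span ℝ {η})ᗮ => f (p • η + (y : E3))) =
        ((fun y : (Submodule.span ℝ {η})ᗮ => p • η + (y : E3)) ⁻¹' closure D).indicator
          fun y => F (p • η + (y : E3)) := by
      ext1 y
      rw [hfi]
      rfl
    rw [h1, integrable_indicator_iff hS.isClosed.measurableSet]
    exact (hF.continuous.comp hcont).continuousOn.integrableOn_compact hS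
  exact ((EuclideanSpace.proj i : E3 →L[ℝ] ℝ).integral_comp_comm hint).symm

/-- The `k`-th derivative of the tangential part of the Radon transform, in coordinates. -/
noncomputable def radonTanDeriv (f : E3 → E3) (η : E3) (k : ℕ) (p : ℝ) : E3 :=
  ∑ i, (iteratedDeriv k (radonScalar (fun x => f x i) η) p -
    ∑ j, η j * η i * iteratedDeriv k (radonScalar (fun x => f x j) η) p) •
      EuclideanSpace.single i (1 : ℝ)

theorem radonTan_eq (hD : IsSmoothConvexDomain D) (hf : IsSmoothFieldSupportedIn D f) (η : E3) :
    (fun p => radonTan f p η) = radonTanDeriv f η 0 := by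
  ext p i
  simp only [radonTan, radonNor, radonTanDeriv, iteratedDeriv_zero, PiLp.sub_apply,
    PiLp.smul_apply, PiLp.inner_apply, radon_apply hD hf, RCLike.inner_apply, conj_trivial,
    smul_eq_mul, WithLp.ofLp_sum, Finset.sum_apply, PiLp.single_apply, mul_ite, mul_one,
    mul_zero, Finset.sum_ite_eq, Finset.mem_univ, if_true, Finset.sum_mul, WithLp.ofLp_smul,
    Pi.smul_apply]
  congr 1
  refine Finset.sum_congr rfl fun j _ => ?_
  ring

theorem hasDerivAt_radonTanDeriv (hD : IsSmoothConvexDomain D)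
    (hf : IsSmoothFieldSupportedIn D f) {x : E3} (hx : x ∈ D) :
    ∃ δ > 0, ∀ (k : ℕ) (η : S2), ∀ p ∈ Metric.ball (inner ℝ (η : E3) x) δ,
      HasDerivAt (radonTanDeriv f η k) (radonTanDeriv f η (k + 1) p) p := by
  obtain ⟨F, hF, hfF, hcut⟩ := hf.exists_isSmoothCutoff
  choose δ hball h using fun i => exists_isRadonRegularAt hD (hcut i) hx
  have hne : (Finset.univ : Finset (Fin 3)).Nonempty := Finset.univ_nonempty
  refine ⟨Finset.univ.inf' hne δ, (Finset.lt_inf'_iff hne).2 fun i _ => (h i).pos,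
    fun k η p hp => ?_⟩
  have hd : ∀ i, HasDerivAt (iteratedDeriv k (radonScalar (fun x => f x i) η))
      (iteratedDeriv (k + 1) (radonScalar (fun x => f x i) η) p) p := by
    intro i
    have hlt : |p - inner ℝ (η : E3) x| < δ i :=
      lt_of_lt_of_le (by rwa [← Real.dist_eq]) (Finset.inf'_le δ (Finset.mem_univ i))
    have := (h i).hasDerivAt k η _ hlt
    rwa [add_sub_cancel] at this
  unfold radonTanDeriv
  refine HasDerivAt.fun_sum fun i _ => HasDerivAt.smul_const ?_ _
  exact (hd i).sub (HasDerivAt.fun_sum fun j _ => (hd j).const_mul _)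

theorem contDiffAt_radonTan (hD : IsSmoothConvexDomain D)
    (hf : IsSmoothFieldSupportedIn D f) {x : E3} (hx : x ∈ D) (η : S2) :
    ContDiffAt ℝ 2 (fun p => radonTan f p (η : E3)) (inner ℝ (η : E3) x) := by
  obtain ⟨δ, hδ, h⟩ := hasDerivAt_radonTanDeriv hD hf hx
  rw [radonTan_eq hD hf]
  have key : ∀ n k : ℕ, ContDiffOn ℝ n (radonTanDeriv f η k)
      (Metric.ball (inner ℝ (η : E3) x) δ) := by
    intro n
    induction n with
    | zero =>
      intro k
      rw [Nat.cast_zero, contDiffOn_zero]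
      exact fun p hp => (h k η p hp).continuousAt.continuousWithinAt
    | succ n ih =>
      intro k
      rw [Nat.cast_succ, contDiffOn_succ_iff_deriv_of_isOpen Metric.isOpen_ball]
      refine ⟨fun p hp => (h k η p hp).differentiableAt.differentiableWithinAt, by simp, ?_⟩
      exact (ih (k + 1)).congr fun p hp => (h k η p hp).deriv
  exact (key 2 0).contDiffAt (Metric.ball_mem_nhds _ hδ)

theorem radonTanSecond_eq (hD : IsSmoothConvexDomain D)
    (hf : IsSmoothFieldSupportedIn D f) {x : E3} (hx : x ∈ D) (η : S2) :
    radonTanSecond f x η = radonTanDeriv f η 2 (inner ℝ (η : E3) x) := by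
  obtain ⟨δ, hδ, h⟩ := hasDerivAt_radonTanDeriv hD hf hx
  rw [radonTanSecond, radonTan_eq hD hf, iteratedDeriv_succ, iteratedDeriv_one]
  have : deriv (radonTanDeriv f (η : E3) 0) =ᶠ[𝓝 (inner ℝ (η : E3) x)] radonTanDeriv f η 1 := by
    filter_upwards [Metric.ball_mem_nhds (inner ℝ (η : E3) x) hδ] with p hp
    exact (h 0 η p hp).deriv
  rw [this.deriv_eq, (h 1 η _ (Metric.mem_ball_self hδ)).deriv]

theorem integrable_radonTan_summand (hD : IsSmoothConvexDomain D)
    (hf : IsSmoothFieldSupportedIn D f) {x : E3} (hx : x ∈ D) (i : Fin 3) :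
    Integrable (fun η : S2 => iteratedDeriv 2 (radonScalar (fun x => f x i) η)
      (inner ℝ (η : E3) x) - ∑ j, (η : E3) j * (η : E3) i *
        iteratedDeriv 2 (radonScalar (fun x => f x j) η) (inner ℝ (η : E3) x)) surfaceMeasure := by
  obtain ⟨F, hF, hfF, hcut⟩ := hf.exists_isSmoothCutoff
  refine Integrable.sub ?_ (integrable_finsetSum _ fun j _ =>
    (hcut j).integrable_backprojection hD
      (continuous_coord_mul_S2 j i) 2 hx)
  simpa using (hcut i).integrable_backprojection hD (c := fun _ => 1) continuous_const 2 hx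

theorem integrable_radonTanSecond (hD : IsSmoothConvexDomain D)
    (hf : IsSmoothFieldSupportedIn D f) {x : E3} (hx : x ∈ D) :
    Integrable (radonTanSecond f x) surfaceMeasure := by
  rw [funext fun η => radonTanSecond_eq hD hf hx η]
  unfold radonTanDeriv
  exact integrable_finsetSum _ fun i _ => (integrable_radonTan_summand hD hf hx i).smul_const _

/-- The scalar potential of the difference between the first part of a field and the field. -/
noncomputable def firstPartPotential (f : E3 → E3) (x : E3) : ℝ :=
  1 / (8 * Real.pi ^ 2) * ∑ j, backprojection (fun y => f y j) (fun η => (η : E3) j) 1 x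

theorem contDiffOn_firstPartPotential (hD : IsSmoothConvexDomain D)
    (hf : IsSmoothFieldSupportedIn D f) : ContDiffOn ℝ 2 (firstPartPotential f) D := by
  obtain ⟨F, hF, hfF, hcut⟩ := hf.exists_isSmoothCutoff
  unfold firstPartPotential
  exact contDiffOn_const.mul (ContDiffOn.sum fun j _ =>
    (hcut j).contDiffOn_backprojection hD 2 (continuous_coord_S2 j) 1)

theorem fderiv_firstPartPotential (hD : IsSmoothConvexDomain D)
    (hf : IsSmoothFieldSupportedIn D f) {x : E3} (hx : x ∈ D) (i : Fin 3) :
    fderiv ℝ (firstPartPotential f) x (EuclideanSpace.single i 1) =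
      1 / (8 * Real.pi ^ 2) * ∑ j, backprojection (fun y => f y j)
        (fun η => (η : E3) j * (η : E3) i) 2 x := by
  obtain ⟨F, hF, hfF, hcut⟩ := hf.exists_isSmoothCutoff
  have hd := fun j => (hcut j).hasFDerivAt_backprojection hD (continuous_coord_S2 j) 1 hx
  have : HasFDerivAt (firstPartPotential f) _ x :=
    (HasFDerivAt.fun_sum fun j (_ : j ∈ Finset.univ) => hd j).const_mul (1 / (8 * Real.pi ^ 2))
  rw [this.fderiv]
  simp

/-- The identity on which everything rests. The full Radon transform inverts to `f`, and the
subtracted normal part is a backprojection with weights `η_j η_i`, which is the `i`-th partial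
derivative of the potential up to the constant. -/
theorem firstPart_eq (hD : IsSmoothConvexDomain D) (hf : IsSmoothFieldSupportedIn D f)
    {x : E3} (hx : x ∈ D) : firstPart f x = f x + gradient (firstPartPotential f) x := by
  obtain ⟨F, hF, hfF, hcut⟩ := hf.exists_isSmoothCutoff
  have hpi := Real.pi_pos
  ext i
  rw [PiLp.add_apply, gradient_apply_coord, fderiv_firstPartPotential hD hf hx]
  have h1 : ∫ η : S2, (iteratedDeriv 2 (radonScalar (fun x => f x i) η)
      (inner ℝ (η : E3) x) - ∑ j, (η : E3) j * (η : E3) i *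
        iteratedDeriv 2 (radonScalar (fun x => f x j) η) (inner ℝ (η : E3) x)) ∂surfaceMeasure =
      -(8 * Real.pi ^ 2) * f x i - ∑ j, backprojection (fun y => f y j)
        (fun η => (η : E3) j * (η : E3) i) 2 x := by
    have hint := fun j => (hcut j).integrable_backprojection hD
      (continuous_coord_mul_S2 j i) 2 hx
    rw [integral_sub _ (integrable_finsetSum _ fun j _ => hint j),
      integral_finsetSum _ fun j _ => hint j, ← (hcut i).backprojection_one_two hD hx]
    · simp [backprojection]
    · simpa using (hcut i).integrable_backprojection hD (c := fun _ => 1) continuous_const 2 hx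
  have h2 : (∫ η, radonTanSecond f x η ∂surfaceMeasure) i =
      -(8 * Real.pi ^ 2) * f x i - ∑ j, backprojection (fun y => f y j)
        (fun η => (η : E3) j * (η : E3) i) 2 x := by
    rw [← h1]
    refine ((EuclideanSpace.proj i : E3 →L[ℝ] ℝ).integral_comp_comm
      (integrable_radonTanSecond hD hf hx)).symm.trans ?_
    refine integral_congr_ae (Eventually.of_forall fun η => ?_)
    simp [radonTanSecond_eq hD hf hx, radonTanDeriv]
  rw [firstPart, PiLp.smul_apply, h2, smul_eq_mul]
  field_simp
  ring

/-- Two derivatives of the potential bring the weight `η_j η_i²`, which sums over `i` to `η_j`. The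
same third order backprojection arises, with opposite sign, from differentiating the inversion
formula for `f_j` in the direction `j`. -/
theorem laplacian_firstPartPotential (hD : IsSmoothConvexDomain D)
    (hf : IsSmoothFieldSupportedIn D f) {x : E3} (hx : x ∈ D) :
    Laplacian.laplacian (firstPartPotential f) x = -divergence f x := by
  obtain ⟨F, hF, hfF, hcut⟩ := hf.exists_isSmoothCutoff
  have hpi := Real.pi_pos
  have hC2 := (contDiffOn_firstPartPotential hD hf).contDiffAt (hD.isOpen.mem_nhds hx)
  have hfd : DifferentiableAt ℝ f x :=
    ((hF.differentiable (by simp)) x).congr_of_eventuallyEq (by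
      filter_upwards [hD.isOpen.mem_nhds hx] with y hy using hfF (subset_closure hy))
  rw [← divergence_gradient hC2, divergence, divergence, ← Finset.sum_neg_distrib]
  have h1 : ∀ i, partialDeriv i i (gradient (firstPartPotential f)) x =
      1 / (8 * Real.pi ^ 2) * ∑ j, backprojection (fun y => f y j)
        (fun η => (η : E3) j * (η : E3) i * (η : E3) i) 3 x := by
    intro i
    rw [partialDeriv_eq_fderiv_coord (differentiableAt_gradient hC2)]
    have hev : (fun y => gradient (firstPartPotential f) y i) =ᶠ[𝓝 x] fun y =>
        1 / (8 * Real.pi ^ 2) * ∑ j, backprojection (fun y => f y j)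
          (fun η => (η : E3) j * (η : E3) i) 2 y := by
      filter_upwards [hD.isOpen.mem_nhds hx] with y hy
      rw [gradient_apply_coord, fderiv_firstPartPotential hD hf hy]
    have hd := fun j => (hcut j).hasFDerivAt_backprojection hD
      (continuous_coord_mul_S2 j i) 2 hx
    have hs := (HasFDerivAt.fun_sum fun j (_ : j ∈ Finset.univ) => hd j).const_mul
      (1 / (8 * Real.pi ^ 2))
    rw [hev.fderiv_eq, hs.fderiv]
    simp
  have h2 : ∀ j, partialDeriv j j f x = -(1 / (8 * Real.pi ^ 2)) *
      backprojection (fun y => f y j) (fun η => (η : E3) j) 3 x := by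
    intro j
    have hev : (fun y => f y j) =ᶠ[𝓝 x] fun y => -(1 / (8 * Real.pi ^ 2)) *
        backprojection (fun y => f y j) (fun _ => 1) 2 y := by
      filter_upwards [hD.isOpen.mem_nhds hx] with y hy
      rw [(hcut j).backprojection_one_two hD hy]
      field_simp
    have hd := ((hcut j).hasFDerivAt_backprojection hD (c := fun _ => 1) continuous_const 2
      hx).const_mul (-(1 / (8 * Real.pi ^ 2)))
    rw [partialDeriv_eq_fderiv_coord hfd, hev.fderiv_eq, hd.fderiv]
    simp
  have h3 : ∀ j, ∑ i, backprojection (fun y => f y j)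
      (fun η => (η : E3) j * (η : E3) i * (η : E3) i) 3 x =
        backprojection (fun y => f y j) (fun η => (η : E3) j) 3 x := by
    intro j
    simp only [backprojection]
    rw [← integral_finsetSum _ fun i _ => (hcut j).integrable_backprojection hD
      (continuous_coord_mul_mul_S2 j i i) 3 hx]
    congr 1
    ext η
    have h1 : ∑ i, (η : E3) i ^ 2 = 1 := by
      rw [← EuclideanSpace.real_norm_sq_eq, norm_coe_S2, one_pow]
    rw [← Finset.sum_mul]
    congr 1
    simp_rw [mul_assoc, ← Finset.mul_sum, ← sq, h1, mul_one]
  simp_rw [h1, h2]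
  rw [← Finset.mul_sum, Finset.sum_comm]
  simp_rw [h3]
  rw [Finset.mul_sum]
  refine Finset.sum_congr rfl fun j _ => ?_
  ring

end VectorRadon

/-! ### The maximum principle on the ball -/

section MaximumPrinciple

/-- Were the second derivative along `v` positive, the restriction to that line would also have a
local minimum. It would then be locally constant, with second derivative zero. -/
theorem fderiv_fderiv_nonpos_of_isLocalMax {u : E3 → ℝ} {x : E3} (hu : ContDiffAt ℝ 2 u x)
    (hm : IsLocalMax u x) (v : E3) : fderiv ℝ (fderiv ℝ u) x v v ≤ 0 := by
  by_contra! hpos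
  have hline : ∀ t : ℝ, HasDerivAt (fun t : ℝ => x + t • v) v t := fun t => by
    simpa using ((hasDerivAt_id t).smul_const v).const_add x
  have hx0 : x + (0 : ℝ) • v = x := by simp
  have htend : Tendsto (fun t : ℝ => x + t • v) (𝓝 0) (𝓝 x) := by
    simpa using (hline 0).continuousAt.tendsto
  have hev : ∀ᶠ y in 𝓝 x, DifferentiableAt ℝ u y := by
    filter_upwards [hu.eventually (by simp)] with y hy using hy.differentiableAt (by simp)
  have hd1 : deriv (fun t : ℝ => u (x + t • v)) =ᶠ[𝓝 0] fun t => fderiv ℝ u (x + t • v) v := by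
    filter_upwards [htend.eventually hev] with t ht
    exact (ht.hasFDerivAt.comp_hasDerivAt t (hline t)).deriv
  have h2 : HasFDerivAt (fderiv ℝ u) (fderiv ℝ (fderiv ℝ u) x) (x + (0 : ℝ) • v) := by
    rw [hx0]
    exact ((hu.fderiv_right (m := 1) (by norm_num)).differentiableAt (by norm_num)).hasFDerivAt
  have h3 : HasDerivAt (fun t : ℝ => fderiv ℝ u (x + t • v)) (fderiv ℝ (fderiv ℝ u) x v) 0 :=
    h2.comp_hasDerivAt 0 (hline 0)
  have hd2 : deriv (deriv fun t : ℝ => u (x + t • v)) 0 = fderiv ℝ (fderiv ℝ u) x v v := by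
    rw [hd1.deriv_eq]
    simpa using (h3.clm_apply (hasDerivAt_const 0 v)).deriv
  have hmax : IsLocalMax (fun t : ℝ => u (x + t • v)) 0 := by
    have := htend.eventually hm
    simpa [IsLocalMax, IsMaxFilter] using this
  have hcont : ContinuousAt (fun t : ℝ => u (x + t • v)) 0 := by
    have h3 : ContinuousAt u (x + (0 : ℝ) • v) := by rw [hx0]; exact hu.continuousAt
    exact ContinuousAt.comp (f := fun t : ℝ => x + t • v) h3 (hline 0).continuousAt
  have hmin : IsLocalMin (fun t : ℝ => u (x + t • v)) 0 :=
    isLocalMin_of_deriv_deriv_pos (by rw [hd2]; exact hpos) hmax.deriv_eq_zero hcont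
  have hconst : (fun t : ℝ => u (x + t • v)) =ᶠ[𝓝 0] fun _ => u (x + (0 : ℝ) • v) := by
    filter_upwards [hmax, hmin] with t h1 h2 using le_antisymm h1 h2
  have hz : deriv (deriv fun t : ℝ => u (x + t • v)) 0 = 0 := by
    rw [hconst.deriv.deriv_eq]
    simp
  rw [hd2] at hz
  exact hpos.ne' hz

theorem laplacian_nonpos_of_isLocalMax {u : E3 → ℝ} {x : E3} (hu : ContDiffAt ℝ 2 u x)
    (hm : IsLocalMax u x) : Laplacian.laplacian u x ≤ 0 := by
  rw [← divergence_gradient hu, divergence]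
  refine Finset.sum_nonpos fun i _ => ?_
  rw [partialDeriv_gradient hu]
  exact fderiv_fderiv_nonpos_of_isLocalMax hu hm _

theorem laplacian_norm_sq (x : E3) : Laplacian.laplacian (fun y : E3 => ‖y‖ ^ 2) x = 6 := by
  have hu : ContDiff ℝ 2 fun y : E3 => ‖y‖ ^ 2 := contDiff_norm_sq ℝ
  rw [← divergence_gradient hu.contDiffAt, divergence]
  have : ∀ i, partialDeriv i i (gradient fun y : E3 => ‖y‖ ^ 2) x = 2 := by
    intro i
    rw [partialDeriv_eq_fderiv_coord (differentiableAt_gradient hu.contDiffAt)]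
    have h1 : (fun y : E3 => gradient (fun y : E3 => ‖y‖ ^ 2) y i) =
        fun y => (2 : ℝ) * (EuclideanSpace.proj i : E3 →L[ℝ] ℝ) y := by
      ext y
      rw [gradient_apply_coord, fderiv_norm_sq_apply]
      simp [EuclideanSpace.inner_single_right]
    rw [h1, fderiv_const_mul (ContinuousLinearMap.differentiableAt _),
      ContinuousLinearMap.fderiv]
    simp
  simp [this]
  norm_num

theorem nonpos_of_laplacian_eq_zero {φ : E3 → ℝ} (hφ : ContDiffOn ℝ 2 φ (Metric.ball 0 1))
    (hc : ContinuousOn φ (Metric.closedBall 0 1)) (h0 : ∀ x ∈ Metric.sphere (0 : E3) 1, φ x = 0)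
    (hΔ : ∀ x ∈ Metric.ball (0 : E3) 1, Laplacian.laplacian φ x = 0) {x : E3}
    (hx : x ∈ Metric.ball (0 : E3) 1) : φ x ≤ 0 := by
  by_contra! hpos
  -- The perturbation `ε‖y‖²` has Laplacian `6ε > 0`, which excludes an interior maximum. On the
  -- sphere the perturbed function equals `ε`, below its value at `x`, so the maximum cannot lie
  -- there either.
  set ε := φ x / 2 with hε
  have hε0 : 0 < ε := half_pos hpos
  have hcw : ContinuousOn (fun y => φ y + ε * ‖y‖ ^ 2) (Metric.closedBall 0 1) :=
    hc.add (by fun_prop)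
  obtain ⟨z, hz, hzmax⟩ := (isCompact_closedBall (0 : E3) 1).exists_isMaxOn
    ⟨x, Metric.ball_subset_closedBall hx⟩ hcw
  have hxz := hzmax (Metric.ball_subset_closedBall hx)
  have hzb : z ∈ Metric.ball (0 : E3) 1 := by
    rw [mem_ball_zero_iff]
    refine lt_of_le_of_ne (mem_closedBall_zero_iff.1 hz) fun h => ?_
    have h1 : φ x + ε * ‖x‖ ^ 2 ≤ φ z + ε * ‖z‖ ^ 2 := hxz
    rw [h0 z (by simpa using h), h] at h1
    have : 0 ≤ ε * ‖x‖ ^ 2 := by positivity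
    linarith
  have hlm : IsLocalMax (fun y => φ y + ε * ‖y‖ ^ 2) z :=
    hzmax.isLocalMax (mem_of_superset (Metric.isOpen_ball.mem_nhds hzb)
      Metric.ball_subset_closedBall)
  have h1 : ContDiffAt ℝ 2 φ z := hφ.contDiffAt (Metric.isOpen_ball.mem_nhds hzb)
  have h2 : ContDiffAt ℝ 2 (fun y : E3 => ‖y‖ ^ 2) z := (contDiff_norm_sq ℝ).contDiffAt
  have h3 : ContDiffAt ℝ 2 (ε • fun y : E3 => ‖y‖ ^ 2) z := contDiffAt_const.smul h2
  have h4 : Laplacian.laplacian (φ + ε • fun y : E3 => ‖y‖ ^ 2) z ≤ 0 :=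
    laplacian_nonpos_of_isLocalMax (h1.add h3) hlm
  rw [h1.laplacian_add h3, InnerProductSpace.laplacian_smul ε h2, laplacian_norm_sq, hΔ z hzb,
    smul_eq_mul] at h4
  linarith

theorem eq_zero_of_laplacian_eq_zero {φ : E3 → ℝ} (hφ : ContDiffOn ℝ 2 φ (Metric.ball 0 1))
    (hc : ContinuousOn φ (Metric.closedBall 0 1)) (h0 : ∀ x ∈ Metric.sphere (0 : E3) 1, φ x = 0)
    (hΔ : ∀ x ∈ Metric.ball (0 : E3) 1, Laplacian.laplacian φ x = 0) {x : E3}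
    (hx : x ∈ Metric.ball (0 : E3) 1) : φ x = 0 := by
  refine le_antisymm (nonpos_of_laplacian_eq_zero hφ hc h0 hΔ hx) ?_
  have h := nonpos_of_laplacian_eq_zero (φ := -φ) hφ.neg hc.neg (fun y hy => by simp [h0 y hy])
    (fun y hy => by simp [InnerProductSpace.laplacian_neg, hΔ y hy]) hx
  simpa using h

end MaximumPrinciple

/-! ### A differentiable cutoff and its bounds -/

section BallCutoff

/-- A `C¹` approximation of the indicator function of the positive half line. -/
noncomputable def positiveCutoff (τ q : ℝ) : ℝ := max q 0 ^ 2 / (max q 0 ^ 2 + τ)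

theorem hasDerivAt_max_zero_sq (q : ℝ) :
    HasDerivAt (fun q : ℝ => max q 0 ^ 2) (2 * max q 0) q := by
  rcases lt_trichotomy q 0 with h | rfl | h
  · rw [max_eq_right h.le, mul_zero]
    refine (hasDerivAt_const q (0 : ℝ)).congr_of_eventuallyEq ?_
    filter_upwards [Iio_mem_nhds h] with s hs
    rw [max_eq_right (le_of_lt hs)]
    norm_num
  · rw [max_self, mul_zero, hasDerivAt_iff_isLittleO]
    simp only [max_self, sub_zero, smul_zero, ne_eq, OfNat.ofNat_ne_zero, not_false_eq_true,
      zero_pow]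
    have h1 : (fun q : ℝ => max q 0 ^ 2) =O[𝓝 0] fun q : ℝ => q ^ 2 := by
      refine Asymptotics.isBigO_of_le _ fun q => ?_
      rw [norm_pow, norm_pow]
      refine pow_le_pow_left₀ (norm_nonneg _) ?_ 2
      rw [Real.norm_of_nonneg (le_max_right _ _), Real.norm_eq_abs]
      exact max_le (le_abs_self q) (abs_nonneg q)
    exact h1.trans_isLittleO (by simpa using Asymptotics.isLittleO_pow_id (𝕜 := ℝ) one_lt_two)
  · rw [max_eq_left h.le]
    have := hasDerivAt_pow 2 q
    refine (this.congr_deriv (by simp)).congr_of_eventuallyEq ?_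
    filter_upwards [Ioi_mem_nhds h] with s hs
    rw [max_eq_left (le_of_lt hs)]

/-- The derivative of `positiveCutoff`. -/
noncomputable def positiveCutoffDeriv (τ q : ℝ) : ℝ :=
  2 * max q 0 * τ / (max q 0 ^ 2 + τ) ^ 2

variable {τ : ℝ}

theorem hasDerivAt_positiveCutoff (hτ : 0 < τ) (q : ℝ) :
    HasDerivAt (positiveCutoff τ) (positiveCutoffDeriv τ q) q := by
  have h := hasDerivAt_max_zero_sq q
  have hne : max q 0 ^ 2 + τ ≠ 0 := by positivity
  refine (h.div (h.add_const τ) hne).congr_deriv ?_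
  rw [positiveCutoffDeriv]
  congr 1
  ring

theorem continuous_positiveCutoffDeriv (hτ : 0 < τ) : Continuous (positiveCutoffDeriv τ) := by
  unfold positiveCutoffDeriv
  refine Continuous.div (by fun_prop) (by fun_prop) fun q => ?_
  positivity

theorem abs_positiveCutoff_le (hτ : 0 < τ) (q : ℝ) : |positiveCutoff τ q| ≤ 1 := by
  rw [positiveCutoff, abs_of_nonneg (by positivity), div_le_one (by positivity)]
  linarith

/-- This is `2q²τ ≤ (q² + τ)²`. The bound is independent of `τ`: the derivative concentrates near
the boundary no faster than `1/q`, which a factor vanishing linearly there compensates. -/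
theorem abs_positiveCutoffDeriv_mul_le (hτ : 0 < τ) {q : ℝ} (hq : 0 < q) :
    |positiveCutoffDeriv τ q| * q ≤ 1 := by
  rw [positiveCutoffDeriv, max_eq_left hq.le, abs_of_nonneg (by positivity), div_mul_eq_mul_div,
    div_le_one (by positivity)]
  nlinarith [sq_nonneg (q ^ 2 - τ), sq_nonneg (q ^ 2 + τ)]

theorem positiveCutoff_of_nonpos {q : ℝ} (hq : q ≤ 0) : positiveCutoff τ q = 0 := by
  rw [positiveCutoff, max_eq_right hq]; simp

theorem positiveCutoffDeriv_of_nonpos {q : ℝ} (hq : q ≤ 0) : positiveCutoffDeriv τ q = 0 := by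
  rw [positiveCutoffDeriv, max_eq_right hq]; simp

theorem tendsto_positiveCutoff {q : ℝ} (hq : 0 < q) :
    Tendsto (fun n : ℕ => positiveCutoff (1 / ((n : ℝ) + 1)) q) atTop (𝓝 1) := by
  have h := (tendsto_one_div_add_atTop_nhds_zero_nat (𝕜 := ℝ)).const_add (max q 0 ^ 2)
  have hne : max q 0 ^ 2 + 0 ≠ 0 := by rw [max_eq_left hq.le]; positivity
  have h2 := (tendsto_const_nhds (x := max q 0 ^ 2) (f := atTop (α := ℕ))).div h hne
  rw [add_zero, div_self (by simpa using hne)] at h2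
  exact h2

theorem tendsto_positiveCutoffDeriv {q : ℝ} (hq : 0 < q) :
    Tendsto (fun n : ℕ => positiveCutoffDeriv (1 / ((n : ℝ) + 1)) q) atTop (𝓝 0) := by
  have h0 := tendsto_one_div_add_atTop_nhds_zero_nat (𝕜 := ℝ)
  have h := (h0.const_add (max q 0 ^ 2)).pow 2
  have hne : (max q 0 ^ 2 + 0) ^ 2 ≠ 0 := by rw [max_eq_left hq.le]; positivity
  have h2 := (h0.const_mul (2 * max q 0)).div h hne
  rw [mul_zero, zero_div] at h2
  exact h2

end BallCutoff

/-! ### Orthogonality of tangential divergence free fields to gradients -/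

section DivergenceFree

theorem hasFDerivAt_ballCutoff {τ : ℝ} (hτ : 0 < τ) (y : E3) :
    HasFDerivAt (fun y : E3 => positiveCutoff τ (1 - ‖y‖ ^ 2))
      (positiveCutoffDeriv τ (1 - ‖y‖ ^ 2) • (-(2 • innerSL ℝ y) : E3 →L[ℝ] ℝ)) y :=
  (hasDerivAt_positiveCutoff hτ _).comp_hasFDerivAt y
    ((hasStrictFDerivAt_norm_sq y).hasFDerivAt.const_sub 1)

theorem one_sub_norm_sq_nonpos {y : E3} (hy : y ∉ Metric.ball (0 : E3) 1) : 1 - ‖y‖ ^ 2 ≤ 0 := by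
  rw [mem_ball_zero_iff, not_lt] at hy
  nlinarith

theorem one_sub_norm_sq_pos {y : E3} (hy : y ∈ Metric.ball (0 : E3) 1) : 0 < 1 - ‖y‖ ^ 2 := by
  rw [mem_ball_zero_iff] at hy
  nlinarith [norm_nonneg y]

theorem hasCompactSupport_of_eq_zero_off_ball {u : E3 → ℝ}
    (hu : ∀ y ∉ Metric.ball (0 : E3) 1, u y = 0) : HasCompactSupport u :=
  HasCompactSupport.intro (isCompact_closedBall (0 : E3) 1) fun y hy =>
    hu y fun h => hy (Metric.ball_subset_closedBall h)

/-- Integration by parts against the smoothed indicator function of the unit ball. -/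
theorem integral_ballCutoff_mul {F : E3 → E3} (hF : ContDiff ℝ 1 F)
    (hdiv : ∀ y ∈ Metric.ball (0 : E3) 1, divergence F y = 0) {u : E3 → ℝ} (hu : ContDiff ℝ 1 u)
    {τ : ℝ} (hτ : 0 < τ) :
    ∫ y, positiveCutoff τ (1 - ‖y‖ ^ 2) * fderiv ℝ u y (F y) =
      ∫ y, positiveCutoffDeriv τ (1 - ‖y‖ ^ 2) * (2 * inner ℝ y (F y)) * u y := by
  set β : E3 → ℝ := fun y => positiveCutoff τ (1 - ‖y‖ ^ 2) with hβ
  have hβd : Differentiable ℝ β := fun y => (hasFDerivAt_ballCutoff hτ y).differentiableAt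
  have hβ0 : ∀ y ∉ Metric.ball (0 : E3) 1, β y = 0 := fun y hy =>
    positiveCutoff_of_nonpos (one_sub_norm_sq_nonpos hy)
  have hFd : Differentiable ℝ F := hF.differentiable (by norm_num)
  have hud : Differentiable ℝ u := hu.differentiable (by norm_num)
  have hFi : ∀ i, ContDiff ℝ 1 fun y => F y i := fun i => contDiff_euclidean.1 hF i
  have hw : ∀ i, ContDiff ℝ 1 fun y => u y * F y i := fun i => hu.mul (hFi i)
  set e : Fin 3 → E3 := fun i => EuclideanSpace.single i (1 : ℝ) with he
  have hβe : ∀ y i, fderiv ℝ β y (e i) = positiveCutoffDeriv τ (1 - ‖y‖ ^ 2) * (-(2 * y i)) := by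
    intro y i
    rw [(hasFDerivAt_ballCutoff hτ y).fderiv]
    simp [he, EuclideanSpace.inner_single_right]
  have hβec : ∀ i, Continuous fun y => fderiv ℝ β y (e i) := by
    intro i
    simp_rw [hβe]
    have := (continuous_positiveCutoffDeriv hτ).comp
      (by fun_prop : Continuous fun y : E3 => 1 - ‖y‖ ^ 2)
    exact this.mul (by fun_prop)
  have hβe0 : ∀ i, ∀ y ∉ Metric.ball (0 : E3) 1, fderiv ℝ β y (e i) = 0 := fun i y hy => by
    rw [hβe, positiveCutoffDeriv_of_nonpos (one_sub_norm_sq_nonpos hy), zero_mul]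
  have hwc : ∀ i, Continuous fun y => fderiv ℝ (fun y => u y * F y i) y (e i) := fun i =>
    ((hw i).continuous_fderiv (by norm_num)).clm_apply continuous_const
  have hint1 : ∀ i, Integrable fun y => fderiv ℝ β y (e i) * (u y * F y i) := fun i =>
    ((hβec i).mul (hw i).continuous).integrable_of_hasCompactSupport
      (hasCompactSupport_of_eq_zero_off_ball fun y hy => by
        simp only [Pi.mul_apply, hβe0 i y hy, zero_mul])
  have hint2 : ∀ i, Integrable fun y => β y * fderiv ℝ (fun y => u y * F y i) y (e i) := fun i =>
    (hβd.continuous.mul (hwc i)).integrable_of_hasCompactSupport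
      (hasCompactSupport_of_eq_zero_off_ball fun y hy => by
        simp only [Pi.mul_apply, hβ0 y hy, zero_mul])
  have hparts : ∀ i, ∫ y, β y * fderiv ℝ (fun y => u y * F y i) y (e i) =
      -∫ y, fderiv ℝ β y (e i) * (u y * F y i) := fun i =>
    integral_mul_fderiv_eq_neg_fderiv_mul_of_integrable (hint1 i) (hint2 i)
      ((hβd.continuous.mul (hw i).continuous).integrable_of_hasCompactSupport
        (hasCompactSupport_of_eq_zero_off_ball fun y hy => by simp only [Pi.mul_apply, hβ0 y hy, zero_mul]))
      (fun y _ => hβd y) fun y _ => (hw i).differentiable (by norm_num) y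
  have hcoord : ∀ v : E3, ∑ i, v i • e i = v := fun v => by
    have := (EuclideanSpace.basisFun (Fin 3) ℝ).sum_repr v
    simpa [he] using this
  have hL : ∀ y, β y * fderiv ℝ u y (F y) =
      ∑ i, β y * fderiv ℝ (fun y => u y * F y i) y (e i) := by
    -- Inside the ball the divergence term of the product rule drops out; outside it the cutoff
    -- vanishes, so nothing is needed about `F` there.
    intro y
    by_cases hy : y ∈ Metric.ball (0 : E3) 1
    · rw [← Finset.mul_sum]
      congr 1
      have h1 : ∀ i, fderiv ℝ (fun y => u y * F y i) y (e i) =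
          u y * partialDeriv i i F y + F y i * fderiv ℝ u y (e i) := by
        intro i
        rw [partialDeriv_eq_fderiv_coord (hFd y),
          fderiv_fun_mul (hud y) ((hFi i).differentiable (by norm_num) y)]
        simp [he]
      simp_rw [h1]
      rw [Finset.sum_add_distrib, ← Finset.mul_sum]
      have h2 : ∑ i, partialDeriv i i F y = 0 := hdiv y hy
      rw [h2, mul_zero, zero_add]
      conv_lhs => rw [← hcoord (F y)]
      simp
    · simp [hβ0 y hy]
  have hR : ∀ y, positiveCutoffDeriv τ (1 - ‖y‖ ^ 2) * (2 * inner ℝ y (F y)) * u y =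
      -∑ i, fderiv ℝ β y (e i) * (u y * F y i) := by
    intro y
    simp only [hβe, PiLp.inner_apply, RCLike.inner_apply, conj_trivial, Finset.mul_sum,
      Finset.sum_mul]
    rw [← Finset.sum_neg_distrib]
    refine Finset.sum_congr rfl fun i _ => ?_
    ring
  refine (integral_congr_ae (Eventually.of_forall hL)).trans
    (Eq.trans ?_ (integral_congr_ae (Eventually.of_forall hR)).symm)
  rw [integral_finsetSum _ fun i _ => hint2 i, integral_neg,
    integral_finsetSum _ fun i _ => hint1 i, ← Finset.sum_neg_distrib]
  exact Finset.sum_congr rfl fun i _ => hparts i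

/-- The radial component vanishes at `y / ‖y‖` by tangency, and `F` is Lipschitz on the closed ball.
Hence the component is at most a multiple of the distance `1 - ‖y‖` to the sphere. -/
theorem exists_abs_inner_le {F : E3 → E3} (hF : ContDiff ℝ 1 F)
    (htan : ∀ η ∈ Metric.sphere (0 : E3) 1, inner ℝ (F η) η = 0) :
    ∃ L, 0 ≤ L ∧ ∀ y ∈ Metric.ball (0 : E3) 1, |inner ℝ y (F y)| ≤ L * (1 - ‖y‖ ^ 2) := by
  obtain ⟨L, hL⟩ := (isCompact_closedBall (0 : E3) 1).exists_bound_of_continuousOn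
    (hF.continuous_fderiv (by norm_num)).continuousOn
  refine ⟨max L 0, le_max_right _ _, fun y hy => ?_⟩
  rcases eq_or_ne y 0 with rfl | hy0
  · simp
  have hn : 0 < ‖y‖ := norm_pos_iff.2 hy0
  have hy1 : ‖y‖ < 1 := mem_ball_zero_iff.1 hy
  set θ : E3 := ‖y‖⁻¹ • y with hθ
  have hθ1 : ‖θ‖ = 1 := by rw [hθ, norm_smul, norm_inv, norm_norm, inv_mul_cancel₀ hn.ne']
  have hyθ : y = ‖y‖ • θ := by rw [hθ, smul_smul, mul_inv_cancel₀ hn.ne', one_smul]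
  have hlip : ‖F y - F θ‖ ≤ L * ‖y - θ‖ :=
    (convex_closedBall (0 : E3) 1).norm_image_sub_le_of_norm_fderiv_le
      (fun z _ => hF.differentiable (by norm_num) z) hL (by simp [hθ1])
      (Metric.ball_subset_closedBall hy)
  have hdist : ‖y - θ‖ = 1 - ‖y‖ := by
    have : y - θ = -((1 - ‖y‖) • θ) := by
      conv_lhs => rw [hyθ]
      module
    rw [this, norm_neg, norm_smul, hθ1, mul_one, Real.norm_of_nonneg (by linarith)]
  have h0 : inner ℝ y (F θ) = 0 := by
    rw [hyθ, inner_smul_left, real_inner_comm, htan θ (by simpa using hθ1), mul_zero]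
  have h1 : inner ℝ y (F y) = inner ℝ y (F y - F θ) := by rw [inner_sub_right, h0, sub_zero]
  rw [h1]
  calc |inner ℝ y (F y - F θ)| ≤ ‖y‖ * ‖F y - F θ‖ := abs_real_inner_le_norm _ _
    _ ≤ 1 * ‖F y - F θ‖ := mul_le_mul_of_nonneg_right hy1.le (norm_nonneg _)
    _ ≤ max L 0 * (1 - ‖y‖) := by
      rw [one_mul, ← hdist]
      exact hlip.trans (mul_le_mul_of_nonneg_right (le_max_left _ _) (norm_nonneg _))
    _ ≤ max L 0 * (1 - ‖y‖ ^ 2) := by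
      refine mul_le_mul_of_nonneg_left ?_ (le_max_right _ _)
      nlinarith

/-- A divergence free field on the ball that is tangential to the sphere is orthogonal to all
gradients. -/
theorem setIntegral_ball_fderiv_eq_zero {F : E3 → E3} (hF : ContDiff ℝ 1 F)
    (hdiv : ∀ y ∈ Metric.ball (0 : E3) 1, divergence F y = 0)
    (htan : ∀ η ∈ Metric.sphere (0 : E3) 1, inner ℝ (F η) η = 0)
    {u : E3 → ℝ} (hu : ContDiff ℝ 1 u) :
    ∫ y in Metric.ball (0 : E3) 1, fderiv ℝ u y (F y) = 0 := by
  obtain ⟨L, hL0, hL⟩ := exists_abs_inner_le hF htan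
  have hGc : Continuous fun y => fderiv ℝ u y (F y) :=
    (hu.continuous_fderiv (by norm_num)).clm_apply hF.continuous
  obtain ⟨A, hA⟩ := (isCompact_closedBall (0 : E3) 1).exists_bound_of_continuousOn hGc.continuousOn
  obtain ⟨B, hB⟩ := (isCompact_closedBall (0 : E3) 1).exists_bound_of_continuousOn
    hu.continuous.continuousOn
  have hpos : ∀ n : ℕ, 0 < 1 / ((n : ℝ) + 1) := fun n => by positivity
  have hbint : ∀ c : ℝ, Integrable ((Metric.ball (0 : E3) 1).indicator fun _ => c) := fun c =>
    (integrable_indicator_iff measurableSet_ball).2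
      (integrableOn_const Metric.isBounded_ball.measure_lt_top.ne)
  have hqc : Continuous fun y : E3 => 1 - ‖y‖ ^ 2 := by fun_prop
  have hbc : ∀ n : ℕ, Continuous (positiveCutoff (1 / ((n : ℝ) + 1))) := fun n =>
    continuous_iff_continuousAt.2 fun q => (hasDerivAt_positiveCutoff (hpos n) q).continuousAt
  have h1 : Tendsto (fun n : ℕ => ∫ y, positiveCutoff (1 / ((n : ℝ) + 1)) (1 - ‖y‖ ^ 2) *
      fderiv ℝ u y (F y)) atTop
      (𝓝 (∫ y, (Metric.ball (0 : E3) 1).indicator (fun y => fderiv ℝ u y (F y)) y)) := by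
    refine tendsto_integral_of_dominated_convergence
      ((Metric.ball (0 : E3) 1).indicator fun _ => A) (fun n => ?_) (hbint A) (fun n => ?_) ?_
    · exact (((hbc n).comp hqc).mul hGc).aestronglyMeasurable
    · refine Eventually.of_forall fun y => ?_
      by_cases hy : y ∈ Metric.ball (0 : E3) 1
      · rw [Set.indicator_of_mem hy, norm_mul]
        refine (mul_le_mul_of_nonneg_right (abs_positiveCutoff_le (hpos n) _)
          (norm_nonneg _)).trans ?_
        rw [one_mul]
        exact hA y (Metric.ball_subset_closedBall hy)
      · rw [Set.indicator_of_notMem hy, positiveCutoff_of_nonpos (one_sub_norm_sq_nonpos hy)]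
        simp
    · refine Eventually.of_forall fun y => ?_
      by_cases hy : y ∈ Metric.ball (0 : E3) 1
      · rw [Set.indicator_of_mem hy]
        simpa using (tendsto_positiveCutoff (one_sub_norm_sq_pos hy)).mul_const
          (fderiv ℝ u y (F y))
      · rw [Set.indicator_of_notMem hy]
        simp_rw [positiveCutoff_of_nonpos (one_sub_norm_sq_nonpos hy), zero_mul]
        exact tendsto_const_nhds
  -- The boundary term. The linear decay of `inner ℝ y (F y)` at the sphere balances the growth of
  -- the cutoff derivative, giving the dominating constant `2 * L * B`; pointwise the derivative
  -- tends to zero.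
  have h2 : Tendsto (fun n : ℕ => ∫ y, positiveCutoffDeriv (1 / ((n : ℝ) + 1)) (1 - ‖y‖ ^ 2) *
      (2 * inner ℝ y (F y)) * u y) atTop (𝓝 (∫ _ : E3, (0 : ℝ))) := by
    refine tendsto_integral_of_dominated_convergence
      ((Metric.ball (0 : E3) 1).indicator fun _ => 2 * L * B) (fun n => ?_) (hbint _)
      (fun n => ?_) ?_
    · have hFc := hF.continuous
      exact ((((continuous_positiveCutoffDeriv (hpos n)).comp hqc).mul (by fun_prop)).mul
        hu.continuous).aestronglyMeasurable
    · refine Eventually.of_forall fun y => ?_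
      by_cases hy : y ∈ Metric.ball (0 : E3) 1
      · rw [Set.indicator_of_mem hy, norm_mul, norm_mul, norm_mul]
        have e1 := abs_positiveCutoffDeriv_mul_le (hpos n) (one_sub_norm_sq_pos hy)
        have e2 := hL y hy
        have e3 := hB y (Metric.ball_subset_closedBall hy)
        refine mul_le_mul ?_ e3 (norm_nonneg _) (by positivity)
        simp only [Real.norm_eq_abs, abs_two]
        calc _ ≤ |positiveCutoffDeriv (1 / ((n : ℝ) + 1)) (1 - ‖y‖ ^ 2)| *
              (2 * (L * (1 - ‖y‖ ^ 2))) := by gcongr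
          _ = 2 * L * (|positiveCutoffDeriv (1 / ((n : ℝ) + 1)) (1 - ‖y‖ ^ 2)| *
              (1 - ‖y‖ ^ 2)) := by ring
          _ ≤ 2 * L := mul_le_of_le_one_right (by positivity) e1
      · rw [Set.indicator_of_notMem hy, positiveCutoffDeriv_of_nonpos (one_sub_norm_sq_nonpos hy)]
        simp
    · refine Eventually.of_forall fun y => ?_
      by_cases hy : y ∈ Metric.ball (0 : E3) 1
      · simpa using ((tendsto_positiveCutoffDeriv (one_sub_norm_sq_pos hy)).mul_const
          (2 * inner ℝ y (F y))).mul_const (u y)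
      · simp_rw [positiveCutoffDeriv_of_nonpos (one_sub_norm_sq_nonpos hy), zero_mul]
        exact tendsto_const_nhds
  simp_rw [fun n : ℕ => integral_ballCutoff_mul hF hdiv hu (hpos n)] at h1
  rw [integral_zero] at h2
  rw [← integral_indicator measurableSet_ball]
  exact tendsto_nhds_unique h1 h2

end DivergenceFree

/-! ### Tangential divergence free fields on the unit ball -/

theorem isSmoothConvexDomain_ball : IsSmoothConvexDomain (Metric.ball (0 : E3) 1) where
  isOpen := Metric.isOpen_ball
  convex := convex_ball 0 1
  isBounded := Metric.isBounded_ball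
  hasSmoothBoundary := by
    intro x hx
    rw [frontier_ball (0 : E3) one_ne_zero, mem_sphere_zero_iff_norm] at hx
    refine ⟨fun y => ‖y‖ ^ 2 - 1, (contDiff_norm_sq ℝ).sub contDiff_const, fun h => ?_,
      Eventually.of_forall fun y => ?_⟩
    · have h1 := congrArg (fun L : E3 →L[ℝ] ℝ => L x) h
      rw [fderiv_sub_const, fderiv_norm_sq_apply] at h1
      simp [hx] at h1
    · rw [mem_ball_zero_iff, sub_neg, sq_lt_one_iff₀ (norm_nonneg y)]

section TangentialField

variable {f : E3 → E3}

/-- Integrated against `ψ(p)`, the normal component of the transform becomes the integral over the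
ball of `ψ(η·y) η·f(y)`. This pairs `f` with the gradient of a function of `η·y`, so it vanishes for
every continuous `ψ`. -/
theorem sum_coord_mul_radonScalar_eq_zero (hf : IsSmoothFieldSupportedIn (Metric.ball 0 1) f)
    (hdiv : ∀ x ∈ Metric.ball (0 : E3) 1, divergence f x = 0)
    (htan : ∀ η ∈ Metric.sphere (0 : E3) 1, inner ℝ (f η) η = 0) (η : S2) {p : ℝ}
    (hp : p ∈ Set.Ioo (-1 : ℝ) 1) :
    ∑ j, (η : E3) j * radonScalar (fun y => f y j) η p = 0 := by
  have hD := isSmoothConvexDomain_ball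
  obtain ⟨F, hF, hfF, hcut⟩ := hf.exists_isSmoothCutoff
  have hF1 : ContDiff ℝ 1 F := hF.of_le (by simp)
  have hcl : closure (Metric.ball (0 : E3) 1) = Metric.closedBall 0 1 :=
    closure_ball 0 one_ne_zero
  have hFdiv : ∀ y ∈ Metric.ball (0 : E3) 1, divergence F y = 0 := by
    intro y hy
    rw [← hdiv y hy]
    refine divergence_congr ?_
    filter_upwards [Metric.isOpen_ball.mem_nhds hy] with z hz
    exact (hfF (subset_closure hz)).symm
  have hFtan : ∀ η ∈ Metric.sphere (0 : E3) 1, inner ℝ (F η) η = 0 := by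
    intro η hη
    rw [← hfF (by rw [hcl]; exact Metric.sphere_subset_closedBall hη)]
    exact htan η hη
  have hη := norm_coe_S2 η
  set J : ℝ → ℝ := fun p => ∑ j, (η : E3) j * radonScalar (fun y => f y j) η p with hJ
  have hJcont : ContinuousOn J (Set.Ioo (-1) 1) := by
    intro q hq
    have hmem : q • (η : E3) ∈ Metric.ball (0 : E3) 1 := by
      rw [mem_ball_zero_iff, norm_smul, hη, mul_one, Real.norm_eq_abs]
      exact abs_lt.2 hq
    refine ContinuousAt.continuousWithinAt (tendsto_finsetSum _ fun j _ => ?_)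
    obtain ⟨δ, -, h⟩ := exists_isRadonRegularAt hD (hcut j) hmem
    have := h.continuousAt η (t := 0) (by simpa using h.pos)
    rw [inner_smul_right, real_inner_self_eq_norm_sq, hη, one_pow, mul_one, add_zero] at this
    exact this.const_mul _
  have hzero : ∀ ψ : ℝ → ℝ, Continuous ψ → ∫ q, ψ q * J q = 0 := by
    intro ψ hψ
    have hΨd : ∀ q, HasDerivAt (fun q => ∫ s in (0 : ℝ)..q, ψ s) (ψ q) q := fun q =>
      intervalIntegral.integral_hasDerivAt_right (hψ.intervalIntegrable _ _)
        hψ.aestronglyMeasurable.stronglyMeasurableAtFilter hψ.continuousAt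
    -- A primitive of `ψ`, so that the gradient of `y ↦ Ψ(η·y)` is `ψ(η·y) η`.
    set Ψ : ℝ → ℝ := fun q => ∫ s in (0 : ℝ)..q, ψ s with hΨ
    have hΨ1 : ContDiff ℝ 1 Ψ := contDiff_one_iff_deriv.2
      ⟨fun q => (hΨd q).differentiableAt, by rwa [funext fun q => (hΨd q).deriv]⟩
    have hu : ContDiff ℝ 1 fun y : E3 => Ψ (inner ℝ (η : E3) y) :=
      hΨ1.comp (contDiff_const.inner ℝ contDiff_id)
    have hkey := setIntegral_ball_fderiv_eq_zero hF1 hFdiv hFtan hu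
    have hint : ∀ j, Integrable fun y => ψ (inner ℝ (η : E3) y) * f y j := by
      intro j
      have hcomp : Continuous fun y : E3 => ψ (inner ℝ (η : E3) y) := hψ.comp (by fun_prop)
      have hind := (hcut j).eq_indicator
      have e1 : (fun y => ψ (inner ℝ (η : E3) y) * f y j) =
          (closure (Metric.ball (0 : E3) 1)).indicator
            fun y => ψ (inner ℝ (η : E3) y) * F y j := by
        ext y
        rw [congrFun hind y]
        by_cases hy : y ∈ closure (Metric.ball (0 : E3) 1)
        · rw [Set.indicator_of_mem hy, Set.indicator_of_mem hy]
        · rw [Set.indicator_of_notMem hy, Set.indicator_of_notMem hy, mul_zero]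
      rw [e1, integrable_indicator_iff isClosed_closure.measurableSet]
      exact (hcomp.mul (hcut j).contDiff.continuous).continuousOn.integrableOn_compact
        hD.isBounded.isCompact_closure
    have e2 : ∫ q, ψ q * J q = ∫ y, ∑ j, (η : E3) j * (ψ (inner ℝ (η : E3) y) * f y j) := by
      rw [integral_finsetSum _ fun j _ => (hint j).const_mul _]
      simp_rw [integral_const_mul]
      simp_rw [fun j => integral_planeWave_mul hη (hint j), ← integral_const_mul]
      rw [← integral_finsetSum]
      · congr 1
        ext q
        rw [hJ, Finset.mul_sum]
        refine Finset.sum_congr rfl fun j _ => ?_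
        ring
      · intro j _
        refine Integrable.const_mul ?_ _
        obtain ⟨b, hb⟩ := exists_orthonormalBasis_zero_eq hη
        have h1 := ((measurePreserving_frameEquiv b).integrable_comp_emb
          (frameEquiv b).measurableEmbedding).2 (hint j)
        rw [Measure.volume_eq_prod] at h1
        refine h1.integral_prod_left.congr (Eventually.of_forall fun q => ?_)
        simp only [Function.comp, frameEquiv_apply, ← hb, inner_frame]
        rw [integral_const_mul, radonScalar_frame]
    rw [e2, ← hkey, ← integral_indicator measurableSet_ball]
    refine integral_congr_ae ?_
    -- The field may be nonzero on the sphere itself, but the sphere is a null set, so integrating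
    -- over the open ball loses nothing.
    have hsph : ∀ᵐ y : E3, y ∉ Metric.sphere (0 : E3) 1 :=
      measure_eq_zero_iff_ae_notMem.1 (Measure.addHaar_sphere volume 0 1)
    filter_upwards [hsph] with y hy
    by_cases hyb : y ∈ Metric.ball (0 : E3) 1
    · rw [Set.indicator_of_mem hyb]
      have h1 : HasFDerivAt (fun y : E3 => Ψ (inner ℝ (η : E3) y))
          (ψ (inner ℝ (η : E3) y) • innerSL ℝ (η : E3)) y :=
        (hΨd _).comp_hasFDerivAt y (innerSL ℝ (η : E3)).hasFDerivAt
      rw [h1.fderiv, ← hfF (subset_closure hyb)]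
      simp only [smul_apply, innerSL_apply_apply, smul_eq_mul, PiLp.inner_apply,
        RCLike.inner_apply, conj_trivial, Finset.mul_sum]
      refine Finset.sum_congr rfl fun j _ => ?_
      ring
    · rw [Set.indicator_of_notMem hyb]
      have hy' : y ∉ closure (Metric.ball (0 : E3) 1) := by
        rw [hcl, ← Metric.ball_union_sphere]
        exact fun h => h.elim hyb hy
      simp [hf.2 y hy']
  -- The fundamental lemma of the calculus of variations gives vanishing almost everywhere;
  -- continuity on the open interval upgrades it to every `p`.
  have hae : ∀ᵐ q : ℝ, q ∈ Set.Ioo (-1 : ℝ) 1 → J q = 0 :=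
    isOpen_Ioo.ae_eq_zero_of_integral_contDiff_smul_eq_zero
      (hJcont.locallyIntegrableOn measurableSet_Ioo) fun ψ hψ _ _ => hzero ψ hψ.continuous
  have hEq := Measure.eqOn_open_of_ae_eq (μ := volume) (f := J) (g := fun _ => 0)
    ((ae_restrict_iff' measurableSet_Ioo).2 hae) isOpen_Ioo hJcont continuousOn_const
  exact hEq hp

/-- For `y` in the ball `|η·y| < 1`, so the vanishing of the normal component near `p = η·y`
annihilates the integrand of the potential. -/
theorem firstPart_eq_self (hf : IsSmoothFieldSupportedIn (Metric.ball 0 1) f)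
    (hdiv : ∀ x ∈ Metric.ball (0 : E3) 1, divergence f x = 0)
    (htan : ∀ η ∈ Metric.sphere (0 : E3) 1, inner ℝ (f η) η = 0) {x : E3}
    (hx : x ∈ Metric.ball (0 : E3) 1) : firstPart f x = f x := by
  have hD := isSmoothConvexDomain_ball
  obtain ⟨F, hF, hfF, hcut⟩ := hf.exists_isSmoothCutoff
  have hpot : ∀ y ∈ Metric.ball (0 : E3) 1, firstPartPotential f y = 0 := by
    intro y hy
    have hsum : ∑ j, backprojection (fun y => f y j) (fun η => (η : E3) j) 1 y = 0 := by
      simp only [backprojection]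
      rw [← integral_finsetSum _ fun j _ =>
        (hcut j).integrable_backprojection hD (continuous_coord_S2 j) 1 hy]
      refine integral_eq_zero_of_ae (Eventually.of_forall fun η => ?_)
      have hmem : inner ℝ (η : E3) y ∈ Set.Ioo (-1 : ℝ) 1 := by
        rw [Set.mem_Ioo, ← abs_lt]
        refine (abs_real_inner_le_norm _ _).trans_lt ?_
        rwa [norm_coe_S2, one_mul, ← mem_ball_zero_iff]
      have hd : ∀ j, HasDerivAt (radonScalar (fun y => f y j) η)
          (iteratedDeriv 1 (radonScalar (fun y => f y j) η) (inner ℝ (η : E3) y))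
          (inner ℝ (η : E3) y) := by
        intro j
        obtain ⟨δ, -, h⟩ := exists_isRadonRegularAt hD (hcut j) hy
        simpa using h.hasDerivAt 0 η 0 (by simpa using h.pos)
      have h1 : HasDerivAt (fun p => ∑ j, (η : E3) j * radonScalar (fun y => f y j) η p) _
          (inner ℝ (η : E3) y) := HasDerivAt.fun_sum fun j _ => (hd j).const_mul ((η : E3) j)
      refine h1.unique ((hasDerivAt_const _ (0 : ℝ)).congr_of_eventuallyEq ?_)
      filter_upwards [isOpen_Ioo.mem_nhds hmem] with p hp
      exact sum_coord_mul_radonScalar_eq_zero hf hdiv htan η hp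
    rw [firstPartPotential, hsum, mul_zero]
  have hev : firstPartPotential f =ᶠ[𝓝 x] fun _ => 0 := by
    filter_upwards [Metric.isOpen_ball.mem_nhds hx] with y hy using hpot y hy
  rw [firstPart_eq hD hf hx, gradient, hev.fderiv_eq]
  simp

end TangentialField

/-! ### The solenoidal part and the main theorem -/

/-- The Laplacian of the potential that relates a field to its solenoidal part. -/
theorem laplacian_eq_divergence_of_eq_add_gradient {D : Set E3} (hD : IsOpen D)
    {f fs : E3 → E3} {φ : E3 → ℝ} (hφ : ContDiffOn ℝ 2 φ D) (hf : DifferentiableOn ℝ f D)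
    (heq : ∀ x ∈ D, f x = fs x + gradient φ x) (hdiv : ∀ x ∈ D, divergence fs x = 0)
    {x : E3} (hx : x ∈ D) : Laplacian.laplacian φ x = divergence f x := by
  have hφx := hφ.contDiffAt (hD.mem_nhds hx)
  have hg := differentiableAt_gradient hφx
  have hfx := hf.differentiableAt (hD.mem_nhds hx)
  -- Differentiability is not part of the definition of a solenoidal part; it follows from `fs = f -
  -- ∇φ` and is needed for additivity of the divergence.
  have hfs : DifferentiableAt ℝ fs x := by
    refine (hfx.sub hg).congr_of_eventuallyEq ?_
    filter_upwards [hD.mem_nhds hx] with y hy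
    rw [Pi.sub_apply, heq y hy, add_sub_cancel_right]
  have hev : f =ᶠ[𝓝 x] fun y => fs y + gradient φ y := by
    filter_upwards [hD.mem_nhds hx] with y hy using heq y hy
  rw [divergence_congr hev, divergence_add hfs hg, hdiv x hx, zero_add, divergence_gradient hφx]

theorem IsSmoothFieldSupportedIn.differentiableOn {D : Set E3} {f : E3 → E3}
    (hf : IsSmoothFieldSupportedIn D f) : DifferentiableOn ℝ f D := by
  obtain ⟨⟨F, hF, hfF⟩, -⟩ := hf
  exact (hF.differentiable (by simp)).differentiableOn.congr fun x hx => hfF (subset_closure hx)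

theorem mainTheorem2 :
    (∀ (D : Set E3) (f : E3 → E3),
      IsOpen D → Convex ℝ D → Bornology.IsBounded D → HasSmoothBoundary D →
      IsSmoothFieldSupportedIn D f →
        -- the integral that defines the first part makes sense, and gives a differentiable field
        (∀ x ∈ D,
          (∀ η : S2, ContDiffAt ℝ 2 (fun p : ℝ => radonTan f p (η : E3)) (inner ℝ (η : E3) x)) ∧
          MeasureTheory.Integrable (radonTanSecond f x) surfaceMeasure) ∧
        DifferentiableOn ℝ (firstPart f) D ∧
        (∀ x ∈ D, curl f x = curl (firstPart f) x) ∧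
        (∀ x ∈ D, divergence (firstPart f) x = 0) ∧
        (∀ fs : E3 → E3, IsSolenoidalPart D f fs →
          ∃ h : E3 → ℝ, InnerProductSpace.HarmonicOnNhd h D ∧
            ∀ x ∈ D, fs x - firstPart f x = gradient h x)) ∧
    (∀ f : E3 → E3, IsSmoothFieldSupportedIn (Metric.ball 0 1) f →
      (∀ x ∈ Metric.ball (0 : E3) 1, divergence f x = 0) →
      (∀ η ∈ Metric.sphere (0 : E3) 1, inner ℝ (f η) η = 0) →
      ∀ fs : E3 → E3, IsSolenoidalPart (Metric.ball 0 1) f fs →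
        ∀ x ∈ Metric.ball (0 : E3) 1, secondPart f fs x = 0) := by
  refine ⟨fun D f h1 h2 h3 h4 hf => ?_, fun f hf hdiv htan fs hfs x hx => ?_⟩
  · have hD : IsSmoothConvexDomain D := ⟨h1, h2, h3, h4⟩
    have hω : ∀ x ∈ D, ContDiffAt ℝ 2 (firstPartPotential f) x := fun x hx =>
      (contDiffOn_firstPartPotential hD hf).contDiffAt (h1.mem_nhds hx)
    have hfd : ∀ x ∈ D, DifferentiableAt ℝ f x := fun x hx =>
      hf.differentiableOn.differentiableAt (h1.mem_nhds hx)
    have hev : ∀ x ∈ D, firstPart f =ᶠ[𝓝 x] fun y => f y + gradient (firstPartPotential f) y :=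
      fun x hx => by
        filter_upwards [h1.mem_nhds hx] with y hy using firstPart_eq hD hf hy
    refine ⟨fun x hx => ⟨contDiffAt_radonTan hD hf hx, integrable_radonTanSecond hD hf hx⟩,
      fun x hx => ?_, fun x hx => ?_, fun x hx => ?_, ?_⟩
    · exact (((hfd x hx).add (differentiableAt_gradient (hω x hx))).congr_of_eventuallyEq
        (hev x hx)).differentiableWithinAt
    · rw [curl_congr (hev x hx), curl_add (hfd x hx) (differentiableAt_gradient (hω x hx)),
        curl_gradient (hω x hx), add_zero]
    · rw [divergence_congr (hev x hx),
        divergence_add (hfd x hx) (differentiableAt_gradient (hω x hx)),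
        divergence_gradient (hω x hx), laplacian_firstPartPotential hD hf hx, add_neg_cancel]
    · rintro fs ⟨φ, hφ, -, -, heq, hdiv⟩
      have hφx : ∀ x ∈ D, ContDiffAt ℝ 2 φ x := fun x hx => hφ.contDiffAt (h1.mem_nhds hx)
      -- The witness comes from `fs - firstPart f = (f - ∇φ) - (f + ∇ω)`; its Laplacian vanishes
      -- because `Δφ = div f` and `Δω = -div f`.
      refine ⟨-(φ + firstPartPotential f), fun x hx =>
        ⟨((hφx x hx).add (hω x hx)).neg, ?_⟩, fun x hx => ?_⟩
      · filter_upwards [h1.mem_nhds hx] with y hy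
        rw [InnerProductSpace.laplacian_neg, Pi.neg_apply, (hφx y hy).laplacian_add (hω y hy),
          laplacian_firstPartPotential hD hf hy,
          laplacian_eq_divergence_of_eq_add_gradient h1 hφ hf.differentiableOn heq hdiv hy]
        simp
      · have hd1 := (hφx x hx).differentiableAt (by norm_num)
        have hd2 := (hω x hx).differentiableAt (by norm_num)
        have : gradient (-(φ + firstPartPotential f)) x =
            -(gradient φ x + gradient (firstPartPotential f) x) := by
          rw [gradient, fderiv_neg, fderiv_add hd1 hd2, map_neg, map_add]
          rfl
        rw [this, firstPart_eq hD hf hx, heq x hx]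
        abel
  · obtain ⟨φ, hφ, hφc, hφ0, heq, hdivs⟩ := hfs
    rw [closure_ball (0 : E3) one_ne_zero] at hφc
    rw [frontier_ball (0 : E3) one_ne_zero] at hφ0
    -- Here `Δφ = div f = 0` and `φ` vanishes on the sphere, so the solenoidal part is `f` itself.
    have hφz : ∀ y ∈ Metric.ball (0 : E3) 1, φ y = 0 := fun y hy =>
      eq_zero_of_laplacian_eq_zero hφ hφc hφ0 (fun z hz => by
        rw [laplacian_eq_divergence_of_eq_add_gradient Metric.isOpen_ball hφ hf.differentiableOn
          heq hdivs hz, hdiv z hz]) hy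
    have hev : φ =ᶠ[𝓝 x] fun _ => 0 := by
      filter_upwards [Metric.isOpen_ball.mem_nhds hx] with y hy using hφz y hy
    have hgrad : gradient φ x = 0 := by
      rw [gradient, hev.fderiv_eq]; simp
    rw [secondPart, firstPart_eq_self hf hdiv htan hx, heq x hx, hgrad, add_zero, sub_self]
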